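/- Let the prototile be the square $Q=[0,3]^2$ carrying the decoration $D$ that consists of the segment from $(0,1)$ to $(3,1)$ and the segment from $(1,1)$ to $(1,0)$; its three \emph{connections} are the points $(0,1),(3,1),(1,0)$ at which $D$ meets the boundary of $Q$. A (monohedral, decorated) tiling is a family of images of $(Q,D)$ under isometries of the plane (reflections allowed) such that the images of $Q$ cover the plane and have pairwise disjoint interiors. A tiling is \emph{generated under rule R2} if its tiles can be placed one after the other, starting with a single seed tile, so that (i) the decoration of each additional tile meets the decoration of an already placed tile, and (ii) at every stage each tile placed so far has an open connection, i.e. one of its three connections lies on the decoration of no other placed tile. A tiling is \emph{nonperiodic} if no translation by a nonzero vector maps its family of decorated tiles onto itself. The \emph{Hilbert polygon of order} $n$ is the path $H_n$ through the $2^n\times 2^n$ array of cells $\{0,\dots,2^n-1\}^2$ defined recursively: $H_0$ is the single cell $(0,0)$, and $H_{n+1}$ is the concatenation of the images of $H_n$ under $(x,y)\mapsto (y,x)$, $(x,y+2^n)$, $(x+2^n,y+2^n)$, $(2^{n+1}-1-y,\,2^n-1-x)$, in this order. A bijection $c:\mathbb Z\to\mathbb Z^2$ is a \emph{two-sided infinite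 Hilbert order} if there are nested intervals $I_0\subseteq I_1\subseteq\cdots$ of integers with $\bigcup_n I_n=\mathbb Z$, $|I_n|=4^n$, such that $c$ restricted to $I_n$ is the image of $H_n$ under an isometry of the lattice $\mathbb Z^2$. Then: (1) There exists a tiling of the whole plane by this prototile, generated under rule R2, such that the union of all decorations is connected and contains a polygonal chain $C$, with vertices indexed by $\mathbb Z$, with the following properties. $C$ is self-avoiding, and unlimited in both directions (it leaves every bounded region in both directions). $C$ is a Hilbert polygonal chain: the tiles are the cells $[3i,3i+3]\times[3j,3j+3]$, $(i,j)\in\mathbb Z^2$, of a square grid, $C$ runs through all of them consecutively in a two-sided infinite Hilbert order, each tile being visited in exactly one of the consecutive sections of $C$, and in each tile it follows the decoration of that tile. $C$ is plane-filling: there is a finite $R$ such that every point of the plane is within distance $R$ of $C$. $C$ is the single such curve: every self-avoiding continuous curve that is contained in the union of the decorations and unlimited in both directions has the same set of points as $C$. (2) Every tiling of the plane by this prototile that is generated under rule R2 is nonperiodic. -/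

import Mathlib

open Set Filter Topology

noncomputable section

namespace HilbertTiling

/-- The Euclidean plane. -/
abbrev Plane : Type := EuclideanSpace ℝ (Fin 2)

/-! ### The decorated prototile -/

/-- The undecorated prototile: the closed square `[0,3] × [0,3]`. -/
def squareTile : Set Plane :=
  {p | 0 ≤ p 0 ∧ p 0 ≤ 3 ∧ 0 ≤ p 1 ∧ p 1 ≤ 3}

/-- The decoration: a segment joining the left side to the right side at height `1`, and a branch
that leaves it at `(1,1)` and runs down to the bottom side. -/
def decoration : Set Plane :=
  segment ℝ (!₂[(0 : ℝ), 1] : Plane) !₂[(3 : ℝ), 1] ∪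
    segment ℝ (!₂[(1 : ℝ), 1] : Plane) !₂[(1 : ℝ), 0]

/-- The three connections of the prototile: the points where its decoration meets its boundary. -/
def connections : Set Plane :=
  {!₂[(0 : ℝ), 1], !₂[(3 : ℝ), 1], !₂[(1 : ℝ), 0]}

/-! ### Tilings by decorated copies of the prototile -/

/-- A placed copy of the decorated prototile, given by an isometry of the plane (reflected copies
are allowed).  Its tile is `g '' squareTile`, its decoration is `g '' decoration`. -/
abbrev Placement : Type := Plane ≃ᵢ Plane

/-- The placed copies cover the plane, and different ones do not overlap. -/
def IsTiling (𝒯 : Set Placement) : Prop :=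
  (⋃ g ∈ 𝒯, g '' squareTile) = univ ∧
    𝒯.Pairwise fun g h => Disjoint (g '' interior squareTile) (h '' interior squareTile)

/-- The union of all decorations. -/
def decorationUnion (𝒯 : Set Placement) : Set Plane :=
  ⋃ g ∈ 𝒯, g '' decoration

/-- Among the placed copies `S`, the copy `g` has an open connection: one of its three connections
lies on the decoration of no other copy in `S`. -/
def HasOpenConnection (S : Set Placement) (g : Placement) : Prop :=
  ∃ x ∈ g '' connections, ∀ h ∈ S, h ≠ g → x ∉ h '' decoration

/-- Matching rule R2.  The tiles of `𝒯` can be placed one after the other, `e 0` being the seed,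
so that the decoration of each additional tile connects to the decoration of an already placed
tile, and at every stage each tile placed so far still has an open connection. -/
def GeneratedByR2 (𝒯 : Set Placement) : Prop :=
  ∃ e : ℕ → Placement, Function.Injective e ∧ range e = 𝒯 ∧
    (∀ n, 0 < n → ∃ m < n, (e n '' decoration ∩ e m '' decoration).Nonempty) ∧
    ∀ n, ∀ m ≤ n, HasOpenConnection (e '' Iic n) (e m)

/-- The family of decorated tiles, each recorded as the pair (tile, decoration). -/
def decoratedTiles (𝒯 : Set Placement) : Set (Set Plane × Set Plane) :=
  (fun g : Placement => (g '' squareTile, g '' decoration)) '' 𝒯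

/-- No translation by a nonzero vector maps the family of decorated tiles onto itself. -/
def IsNonperiodic (𝒯 : Set Placement) : Prop :=
  ∀ w : Plane, w ≠ 0 →
    (fun P : Set Plane × Set Plane => ((fun x => w + x) '' P.1, (fun x => w + x) '' P.2)) ''
      decoratedTiles 𝒯 ≠ decoratedTiles 𝒯

/-! ### Polygonal chains -/

/-- The two-sided polygonal chain with vertices `…, v (-1), v 0, v 1, …`, parametrized so that
vertex `v k` is reached at time `k`. -/
def polyline (v : ℤ → Plane) (s : ℝ) : Plane :=
  AffineMap.lineMap (v ⌊s⌋) (v (⌊s⌋ + 1)) (Int.fract s)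

/-- A self-avoiding curve that is unlimited in both directions: it leaves every bounded region
both in the past and in the future. -/
def IsUnlimitedSelfAvoiding (γ : ℝ → Plane) : Prop :=
  Continuous γ ∧ Function.Injective γ ∧ Tendsto γ (cocompact ℝ) (cocompact Plane)

/-- All points of the plane are within a fixed finite distance of `C`. -/
def IsPlaneFilling (C : Set Plane) : Prop :=
  ∃ R : ℝ, ∀ p : Plane, ∃ q ∈ C, dist p q ≤ R

/-! ### The Hilbert order -/

/-- `hilbert n i`, for `i < 4 ^ n`, is the `i`-th cell that the Hilbert polygon of order `n` visits
in the `2 ^ n × 2 ^ n` array of cells; it starts at the lower left and ends at the lower right. -/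
def hilbert : ℕ → ℕ → ℤ × ℤ
  | 0, _ => (0, 0)
  | n + 1, i =>
    let p := hilbert n (i % 4 ^ n)
    match i / 4 ^ n with
    | 0 => (p.2, p.1)
    | 1 => (p.1, p.2 + 2 ^ n)
    | 2 => (p.1 + 2 ^ n, p.2 + 2 ^ n)
    | _ => (2 * 2 ^ n - 1 - p.2, 2 ^ n - 1 - p.1)

/-- An isometry of the square lattice. -/
def IsLatticeIsometry (φ : ℤ × ℤ → ℤ × ℤ) : Prop :=
  ∀ p q, ((φ p).1 - (φ q).1) ^ 2 + ((φ p).2 - (φ q).2) ^ 2 = (p.1 - q.1) ^ 2 + (p.2 - q.2) ^ 2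

/-- A two-sided infinite Hilbert order of the cells of the plane: it visits every cell exactly
once, and it is the union of a growing sequence of sections, the `n`-th of which is congruent to
the Hilbert polygon of order `n`. -/
def IsInfiniteHilbertOrder (c : ℤ → ℤ × ℤ) : Prop :=
  Function.Bijective c ∧
    ∃ a : ℕ → ℤ,
      (∀ n, a (n + 1) ≤ a n ∧ a n + 4 ^ n ≤ a (n + 1) + 4 ^ (n + 1)) ∧
      (∀ k, ∃ n, a n ≤ k ∧ k < a n + 4 ^ n) ∧
      ∀ n, ∃ φ : ℤ × ℤ → ℤ × ℤ, IsLatticeIsometry φ ∧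
        ∀ i : ℕ, i < 4 ^ n → c (a n + (i : ℤ)) = φ (hilbert n i)

/-- The cell with index `z` of the square grid of mesh `3`. -/
def gridSquare (z : ℤ × ℤ) : Set Plane :=
  {p | 3 * (z.1 : ℝ) ≤ p 0 ∧ p 0 ≤ 3 * (z.1 : ℝ) + 3 ∧
    3 * (z.2 : ℝ) ≤ p 1 ∧ p 1 ≤ 3 * (z.2 : ℝ) + 3}

/-- The chain with vertices `v` is a Hilbert polygonal chain of the tiling `𝒯`: the tiles of `𝒯`
are the cells of the square grid, enumerated by `t` in a two-sided infinite Hilbert order, and the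
chain runs through the tiles in this order, inside tile `t k` along the decoration of `t k`. -/
def IsHilbertChain (𝒯 : Set Placement) (v : ℤ → Plane) : Prop :=
  ∃ (c : ℤ → ℤ × ℤ) (t : ℤ → Placement) (τ : ℤ → ℤ),
    IsInfiniteHilbertOrder c ∧
    Function.Injective t ∧ range t = 𝒯 ∧
    (∀ k, t k '' squareTile = gridSquare (c k)) ∧
    StrictMono τ ∧
    ∀ k, polyline v '' Icc (τ k : ℝ) (τ (k + 1) : ℝ) ⊆ t k '' decoration

end HilbertTiling

end

noncomputable section

namespace HilbertTiling

/-! ### The prototile -/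

/-! Nonperiodicity. Decorations of non-overlapping tiles meet only at common connections. There each
tile fills a half-disc, so the inward normals are opposite and at most two tiles share the point.
Rule R2 leaves every tile an open connection in the finished tiling, so the graph of tiles with
meeting decorations is connected and has degree at most two. A period `w` acts on it without orbits
of length one or two, because no nonempty compact set is invariant under `w` or `2w`. This excludes
reflections of the path, so the period acts as a shift with finitely many orbits
(`exists_finite_orbit_representatives`). Finitely many tiles and their translates along `w` lie in a
strip, which is not the plane (`not_cover_of_finite_orbits`).

Existence. Given a path through all cells of the grid, each tile is placed so that two of its arms
follow the path and the third is a dead end: a straight passage uses the long segment, a turn uses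
the branch and one half of the long segment. Connections are off-centre, and where the path leaves a
cell the side of the displacement is forced by the most recent turn; reflections allow the next tile
to match it. The dead end is perpendicular to the incoming step and displaced backwards along it, so
two dead ends meet only if the incoming steps of neighbouring cells are parallel, adjacent and in
the same direction. A path without such pairs of steps therefore gives a tiling connected exactly
along the path (`exists_pathTiling`), and the dead ends are the open connections that R2 requires.

The Hilbert polygon has no such pairs (`hilbert_no_parallel`). Its recursion by quadrants is
converted into a refinement that replaces each cell by an oriented 2 × 2 block (`hilbert_refine`),
after which only finite checks on neighbouring blocks remain. Placing each section of even order as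
an inner one of the sixteen parts of the next gives a two-sided order that exhausts the plane.

Uniqueness. A self-avoiding curve that enters a dead end can pass its junction only once, so in one
time direction it is trapped in a compact arm. Hence an unlimited curve lies on the chain, and a
properly embedded line contains no other properly embedded line than itself
(`range_eq_of_range_subset`). -/

theorem plane_ext {p q : Plane} (h0 : p 0 = q 0) (h1 : p 1 = q 1) : p = q := by
  ext i
  fin_cases i
  · exact h0
  · exact h1

theorem mem_decoration {p : Plane} :
    p ∈ decoration ↔ (p 1 = 1 ∧ 0 ≤ p 0 ∧ p 0 ≤ 3) ∨ (p 0 = 1 ∧ 0 ≤ p 1 ∧ p 1 ≤ 1) := by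
  unfold decoration
  rw [mem_union]
  refine or_congr ⟨?_, ?_⟩ ⟨?_, ?_⟩
  · rintro ⟨a, b, ha, hb, hab, rfl⟩
    simp
    refine ⟨by linarith, hb, by linarith⟩
  · rintro ⟨h1, h0, h3⟩
    refine ⟨1 - p 0 / 3, p 0 / 3, by linarith, by linarith, by ring, plane_ext ?_ ?_⟩
    · simp
    · simp [h1]
  · rintro ⟨a, b, ha, hb, hab, rfl⟩
    simp
    refine ⟨by linarith, ha, by linarith⟩
  · rintro ⟨h1, h0, h3⟩
    refine ⟨p 1, 1 - p 1, by linarith, by linarith, by ring, plane_ext ?_ ?_⟩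
    · simp [h1]
    · simp

theorem decoration_subset_squareTile : decoration ⊆ squareTile := by
  intro p hp
  rcases mem_decoration.1 hp with ⟨h1, h2, h3⟩ | ⟨h1, h2, h3⟩
  · exact ⟨h2, h3, by linarith, by linarith⟩
  · exact ⟨by linarith, by linarith, h2, by linarith⟩

theorem interior_box (a b c d : ℝ) :
    interior {p : Plane | a ≤ p 0 ∧ p 0 ≤ b ∧ c ≤ p 1 ∧ p 1 ≤ d} =
      {p : Plane | a < p 0 ∧ p 0 < b ∧ c < p 1 ∧ p 1 < d} := by
  have ho : ∀ i : Fin 2, IsOpenMap (EuclideanSpace.proj i : Plane →L[ℝ] ℝ) := fun i =>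
    ContinuousLinearMap.isOpenMap _ fun r => ⟨EuclideanSpace.single i r, by simp⟩
  have hc : ∀ i : Fin 2, Continuous (EuclideanSpace.proj i : Plane →L[ℝ] ℝ) := fun i =>
    ContinuousLinearMap.continuous _
  have h : {p : Plane | a ≤ p 0 ∧ p 0 ≤ b ∧ c ≤ p 1 ∧ p 1 ≤ d} =
      (EuclideanSpace.proj 0 : Plane →L[ℝ] ℝ) ⁻¹' Icc a b ∩
        (EuclideanSpace.proj 1 : Plane →L[ℝ] ℝ) ⁻¹' Icc c d := by
    ext p; simp [and_assoc]
  rw [h, interior_inter, ← (ho 0).preimage_interior_eq_interior_preimage (hc 0),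
    ← (ho 1).preimage_interior_eq_interior_preimage (hc 1), interior_Icc, interior_Icc]
  ext p; simp [and_assoc]

theorem interior_squareTile :
    interior squareTile = {p : Plane | 0 < p 0 ∧ p 0 < 3 ∧ 0 < p 1 ∧ p 1 < 3} :=
  interior_box 0 3 0 3

theorem interior_squareTile_nonempty : (interior squareTile).Nonempty := by
  rw [interior_squareTile]
  exact ⟨!₂[1, 1], by simp⟩

theorem convex_squareTile : Convex ℝ squareTile := by
  intro p hp q hq a b ha hb hab
  obtain ⟨h1, h2, h3, h4⟩ := hp
  obtain ⟨k1, k2, k3, k4⟩ := hq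
  simp only [squareTile, mem_ofPred_eq, PiLp.add_apply, PiLp.smul_apply, smul_eq_mul]
  refine ⟨by positivity, ?_, by positivity, ?_⟩ <;> nlinarith

theorem squareTile_subset_closure : squareTile ⊆ closure (interior squareTile) := by
  rw [convex_squareTile.closure_interior_eq_closure_of_nonempty_interior
    interior_squareTile_nonempty]
  exact subset_closure

theorem isOpen_image_interior (g : Placement) : IsOpen (g '' interior squareTile) :=
  g.toHomeomorph.isOpenMap _ isOpen_interior

theorem mem_interior_of_mem_decoration {p : Plane} (hp : p ∈ decoration)
    (h : p ∉ connections) : p ∈ interior squareTile := by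
  rw [interior_squareTile]
  simp only [connections, mem_insert_iff, mem_singleton_iff, not_or] at h
  obtain ⟨hA, hB, hD⟩ := h
  rcases mem_decoration.1 hp with ⟨h1, h2, h3⟩ | ⟨h1, h2, h3⟩
  · refine ⟨lt_of_le_of_ne h2 fun h => hA ?_, lt_of_le_of_ne h3 fun h => hB ?_, ?_, ?_⟩
    · exact plane_ext (by simp [← h]) (by simp [h1])
    · exact plane_ext (by simp [h]) (by simp [h1])
    · linarith
    · linarith
  · refine ⟨by linarith, by linarith, lt_of_le_of_ne h2 fun h => hD ?_, by linarith⟩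
    exact plane_ext (by simp [h1]) (by simp [← h])

/-- Decorations of tiles that do not overlap meet only in common connections. -/
theorem mem_connections_of_mem_decoration {g h : Placement} {x : Plane}
    (hgh : Disjoint (g '' interior squareTile) (h '' interior squareTile))
    (hg : x ∈ g '' decoration) (hh : x ∈ h '' decoration) : x ∈ g '' connections := by
  obtain ⟨p, hp, rfl⟩ := hg
  refine mem_image_of_mem g ?_
  by_contra hc
  have hint : g p ∈ g '' interior squareTile :=
    mem_image_of_mem g (mem_interior_of_mem_decoration hp hc)
  have hcl : g p ∈ closure (h '' interior squareTile) := by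
    obtain ⟨q, hq, hqp⟩ := hh
    rw [← hqp]
    exact image_closure_subset_closure_image h.continuous
      (mem_image_of_mem h (squareTile_subset_closure (decoration_subset_squareTile hq)))
  obtain ⟨y, hy1, hy2⟩ := mem_closure_iff.1 hcl _ (isOpen_image_interior g) hint
  exact disjoint_left.1 hgh hy1 hy2

/-- Near a connection, the prototile fills a half-disc. -/
theorem exists_inward_normal {p : Plane} (hp : p ∈ connections) :
    ∃ m : Plane, ‖m‖ = 1 ∧
      ∀ q, dist q p < 1 → 0 < inner ℝ (q - p) m → q ∈ interior squareTile := by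
  have key : ∀ q p : Plane, dist q p < 1 → |q 0 - p 0| < 1 ∧ |q 1 - p 1| < 1 := by
    intro q p h
    constructor
    · exact lt_of_le_of_lt (by simpa [dist_eq_norm] using PiLp.norm_apply_le (q - p) 0) h
    · exact lt_of_le_of_lt (by simpa [dist_eq_norm] using PiLp.norm_apply_le (q - p) 1) h
  rw [interior_squareTile]
  rcases hp with rfl | rfl | rfl
  · refine ⟨!₂[1, 0], by simp [EuclideanSpace.norm_eq], fun q hq hi => ?_⟩
    have := key _ _ hq
    simp [PiLp.inner_apply, abs_lt] at this hi ⊢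
    refine ⟨?_, ?_, ?_, ?_⟩ <;> linarith
  · refine ⟨!₂[-1, 0], by simp [EuclideanSpace.norm_eq], fun q hq hi => ?_⟩
    have := key _ _ hq
    simp [PiLp.inner_apply, abs_lt] at this hi ⊢
    refine ⟨?_, ?_, ?_, ?_⟩ <;> linarith
  · refine ⟨!₂[0, 1], by simp [EuclideanSpace.norm_eq], fun q hq hi => ?_⟩
    have := key _ _ hq
    simp [PiLp.inner_apply, abs_lt] at this hi ⊢
    refine ⟨?_, ?_, ?_, ?_⟩ <;> linarith

theorem exists_affineIsometry (g : Placement) :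
    ∃ f : Plane ≃ᵃⁱ[ℝ] Plane, ∀ p, f p = g p :=
  ⟨g.toRealAffineIsometryEquiv, fun p => by simp⟩

theorem exists_inward_normal_image {g : Placement} {x : Plane} (hx : x ∈ g '' connections) :
    ∃ m : Plane, ‖m‖ = 1 ∧
      ∀ q, dist q x < 1 → 0 < inner ℝ (q - x) m → q ∈ g '' interior squareTile := by
  obtain ⟨p, hp, rfl⟩ := hx
  obtain ⟨m, hm, h⟩ := exists_inward_normal hp
  obtain ⟨f, hf⟩ := exists_affineIsometry g
  refine ⟨f.linearIsometryEquiv m, by simpa using hm, fun q hq hi => ?_⟩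
  obtain ⟨r, rfl⟩ := g.surjective q
  refine mem_image_of_mem g (h r ?_ ?_)
  · rwa [g.isometry.dist_eq] at hq
  · have : g r - g p = f.linearIsometryEquiv (r - p) := by
      rw [← hf, ← hf]
      exact (f.map_vsub r p).symm
    rwa [this, LinearIsometryEquiv.inner_map_map] at hi

/-- Otherwise `m + n` has positive inner product `‖m + n‖² / 2` with both unit normals, so a short
step from `x` along it enters both interiors. The factor 1/4 keeps that step shorter than 1. -/
theorem normal_add_eq_zero {g h : Placement} {x m n : Plane}
    (hgh : Disjoint (g '' interior squareTile) (h '' interior squareTile))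
    (hm : ‖m‖ = 1) (hn : ‖n‖ = 1)
    (hg : ∀ q, dist q x < 1 → 0 < inner ℝ (q - x) m → q ∈ g '' interior squareTile)
    (hh : ∀ q, dist q x < 1 → 0 < inner ℝ (q - x) n → q ∈ h '' interior squareTile) :
    m + n = 0 := by
  by_contra hne
  have hpos : 0 < ‖m + n‖ ^ 2 := by positivity
  rw [norm_add_sq_real, hm, hn] at hpos
  have hd : dist (x + (1 / 4 : ℝ) • (m + n)) x < 1 := by
    rw [dist_eq_norm, add_sub_cancel_left, norm_smul]
    have := norm_add_le m n
    rw [hm, hn] at this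
    norm_num
    linarith
  refine disjoint_left.1 hgh (hg _ hd ?_) (hh _ hd ?_)
  · rw [add_sub_cancel_left, inner_smul_left, inner_add_left, real_inner_self_eq_norm_sq, hm,
      real_inner_comm]
    simp
    linarith
  · rw [add_sub_cancel_left, inner_smul_left, inner_add_left, real_inner_self_eq_norm_sq, hn]
    simp
    linarith

/-- A point is a connection of at most two tiles of a family of tiles that do not overlap. -/
theorem not_three_connections {g h k : Placement} {x : Plane}
    (hgh : Disjoint (g '' interior squareTile) (h '' interior squareTile))
    (hgk : Disjoint (g '' interior squareTile) (k '' interior squareTile))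
    (hhk : Disjoint (h '' interior squareTile) (k '' interior squareTile))
    (hxg : x ∈ g '' connections) (hxh : x ∈ h '' connections) (hxk : x ∈ k '' connections) :
    False := by
  obtain ⟨a, ha, ha'⟩ := exists_inward_normal_image hxg
  obtain ⟨b, hb, hb'⟩ := exists_inward_normal_image hxh
  obtain ⟨c, hc, hc'⟩ := exists_inward_normal_image hxk
  have h1 := normal_add_eq_zero hgh ha hb ha' hb'
  have h2 := normal_add_eq_zero hgk ha hc ha' hc'
  have h3 := normal_add_eq_zero hhk hb hc hb' hc'
  have h4 : a = -b := eq_neg_of_add_eq_zero_left h1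
  have h5 : c = -b := eq_neg_of_add_eq_zero_right h3
  have h6 : (2 : ℝ) • b = 0 := by
    rw [h4, h5] at h2
    rw [two_smul, ← neg_eq_zero, neg_add, h2]
  have h7 : b = 0 := by simpa using h6
  rw [h7, norm_zero] at hb
  exact zero_ne_one hb

/-! ### Automorphisms of graphs of degree at most two -/

/-- A permutation of the vertices of a connected graph of degree at most two that preserves
adjacency and has no orbits of length one or two has only finitely many orbits. -/
theorem exists_finite_orbit_representatives {V : Type*} (G : SimpleGraph V) (hG : G.Connected)
    (hdeg : ∀ v a b c, G.Adj v a → G.Adj v b → G.Adj v c → a = b ∨ a = c ∨ b = c)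
    (T : Equiv.Perm V) (hT : ∀ a b, G.Adj (T a) (T b) ↔ G.Adj a b)
    (h1 : ∀ v, T v ≠ v) (h2 : ∀ v, T (T v) ≠ v) :
    ∃ F : Set V, F.Finite ∧ ∀ v, ∃ x ∈ F, ∃ k : ℤ, v = (T ^ k) x := by
  classical
  -- The length is minimised over the starting vertex as well as over the walk, because one of the
  -- shortcuts below changes the starting vertex. The translates of a shortest walk fit together
  -- without backtracking.
  have hex : ∃ l : ℕ, ∃ p : ℕ → V, p l = T (p 0) ∧ ∀ i < l, G.Adj (p i) (p (i + 1)) := by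
    obtain ⟨a⟩ := hG.nonempty
    obtain ⟨w⟩ := hG.preconnected a (T a)
    exact ⟨w.length, w.getVert, by simp, fun i hi => w.adj_getVert_succ hi⟩
  obtain ⟨p, hpl, hp⟩ := Nat.find_spec hex
  have hmin := fun {m} => Nat.find_min hex (m := m)
  set l := Nat.find hex with hl
  have hl0 : 0 < l := by
    rcases Nat.eq_zero_or_pos l with h | h
    · rw [h] at hpl
      exact absurd hpl.symm (h1 _)
    · exact h
  have hTz : ∀ (k : ℤ) a b, G.Adj ((T ^ k) a) ((T ^ k) b) ↔ G.Adj a b := by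
    intro k
    induction k using Int.induction_on with
    | zero => simp
    | succ n ih =>
      intro a b
      rw [add_comm, zpow_add, zpow_one, Equiv.Perm.mul_apply, Equiv.Perm.mul_apply, hT, ih]
    | pred n ih =>
      intro a b
      rw [← hT, ← Equiv.Perm.mul_apply, ← Equiv.Perm.mul_apply, ← zpow_one_add,
        add_sub_cancel, ih]
  -- the neighbours of the vertices of the walk
  have hnbr : ∀ i < l, ∃ u v, u ≠ v ∧ G.Adj (p i) u ∧ G.Adj (p i) v ∧
      (∃ k : ℤ, ∃ j < l, u = (T ^ k) (p j)) ∧ (∃ k : ℤ, ∃ j < l, v = (T ^ k) (p j)) := by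
    have hnext : ∀ i < l, ∃ k : ℤ, ∃ j < l, p (i + 1) = (T ^ k) (p j) := by
      intro i hi
      rcases Nat.lt_or_ge (i + 1) l with h | h
      · exact ⟨0, i + 1, h, by simp⟩
      · have : i + 1 = l := by omega
        exact ⟨1, 0, hl0, by rw [this, hpl]; simp⟩
    intro i hi
    rcases Nat.eq_zero_or_pos i with rfl | hi0
    · have hadj : G.Adj (p 0) (T⁻¹ (p (l - 1))) := by
        rw [← hT, show T (T⁻¹ (p (l - 1))) = p (l - 1) by simp, ← hpl]
        have := hp (l - 1) (by omega)
        rw [Nat.sub_add_cancel hl0] at this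
        exact this.symm
      refine ⟨p (0 + 1), T⁻¹ (p (l - 1)), fun he => ?_, hp 0 hi, hadj, hnext 0 hi,
        -1, l - 1, by omega, by simp⟩
      -- Backtracking where two translates of the walk meet: dropping both end steps leaves a walk
      -- from `p 1` to `T (p 1)`. If `l = 1` this is impossible, but then `T` would have an orbit of
      -- length two.
      have he' : p (l - 1) = T (p 1) := by rw [zero_add] at he; rw [he]; simp
      rcases Nat.lt_or_ge 1 l with h | h
      · refine hmin (m := l - 2) (by omega) ⟨fun j => p (j + 1), ?_, fun j hj => ?_⟩
        · have : l - 2 + 1 = l - 1 := by omega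
          simpa [this] using he'
        · exact hp (j + 1) (by omega)
      · have hl1 : l = 1 := by omega
        rw [hl1] at he' hpl
        simp only [Nat.sub_self] at he'
        rw [hpl] at he'
        exact h2 _ he'.symm
    · have hadj := hp (i - 1) (by omega)
      rw [Nat.sub_add_cancel hi0] at hadj
      refine ⟨p (i + 1), p (i - 1), fun he => ?_, hp i hi, hadj.symm, hnext i hi,
        0, i - 1, by omega, by simp⟩
      -- Backtracking inside the walk: the detour through `p i` is cut out.
      refine hmin (m := l - 2) (by omega) ⟨fun j => if j < i then p j else p (j + 2), ?_, ?_⟩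
      · simp only [hi0, if_true]
        split_ifs with h
        · have e1 : l - 2 = i - 1 := by omega
          have e2 : i + 1 = l := by omega
          rw [e1, ← he, e2, hpl]
        · have e1 : l - 2 + 2 = l := by omega
          rw [e1, hpl]
      · intro j hj
        beta_reduce
        rcases Nat.lt_trichotomy (j + 1) i with h | h | h
        · rw [if_pos h, if_pos (by omega)]
          exact hp j (by omega)
        · rw [if_pos (show j < i by omega), if_neg (show ¬ j + 1 < i by omega)]
          have e1 : j = i - 1 := by omega
          have e2 : j + 1 + 2 = i + 1 + 1 := by omega
          rw [e2, e1, ← he]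
          exact hp (i + 1) (by omega)
        · rw [if_neg (by omega), if_neg (by omega)]
          exact hp (j + 2) (by omega)
  let S : Set V := {v | ∃ k : ℤ, ∃ j < l, v = (T ^ k) (p j)}
  have hS : ∀ v w, G.Adj v w → v ∈ S → w ∈ S := by
    rintro v w hvw ⟨k, i, hi, rfl⟩
    obtain ⟨a, b, hab, ha, hb, ⟨m, j, hj, rfl⟩, ⟨n, j', hj', rfl⟩⟩ := hnbr i hi
    have hw : G.Adj (p i) ((T ^ (-k)) w) := by
      rw [← hTz k, ← Equiv.Perm.mul_apply, ← zpow_add]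
      simpa using hvw
    have hww : w = (T ^ k) ((T ^ (-k)) w) := by
      rw [← Equiv.Perm.mul_apply, ← zpow_add]; simp
    -- The translated walk already supplies two distinct neighbours, so the degree bound leaves no
    -- room for a third. Hence `S` is closed under adjacency and, by connectedness, is everything.
    rcases hdeg _ _ _ _ ha hb hw with h | h | h
    · exact absurd h hab
    · refine ⟨k + m, j, hj, ?_⟩
      rw [hww, ← h, zpow_add, Equiv.Perm.mul_apply]
    · refine ⟨k + n, j', hj', ?_⟩
      rw [hww, ← h, zpow_add, Equiv.Perm.mul_apply]
  have hwalk : ∀ v w, G.Walk v w → v ∈ S → w ∈ S := by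
    intro v w q
    induction q with
    | nil => exact id
    | cons h _ ih => exact fun hv => ih (hS _ _ h hv)
  refine ⟨p '' Iio l, (finite_Iio l).image p, fun v => ?_⟩
  obtain ⟨q⟩ := hG.preconnected (p 0) v
  obtain ⟨k, j, hj, hv⟩ := hwalk _ _ q ⟨0, 0, hl0, by simp⟩
  exact ⟨p j, mem_image_of_mem p hj, k, hv⟩

/-! ### Nonperiodicity -/

/-- A period acts on sets, while the tiling is a set of isometries; within a tiling the undecorated
square already determines the isometry, so the period induces a permutation of the tile indices. -/
theorem image_squareTile_injOn {𝒯 : Set Placement} (ht : IsTiling 𝒯) {g h : Placement}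
    (hg : g ∈ 𝒯) (hh : h ∈ 𝒯) (he : g '' squareTile = h '' squareTile) : g = h := by
  by_contra hne
  have hd : Disjoint (g '' interior squareTile) (h '' interior squareTile) := ht.2 hg hh hne
  have hi : ∀ f : Placement, f '' interior squareTile = interior (f '' squareTile) :=
    fun f => f.toHomeomorph.image_interior _
  rw [hi, hi, he, disjoint_self, ← hi] at hd
  exact (interior_squareTile_nonempty.image h).ne_empty hd

/-- Under rule R2, every tile keeps an open connection in the complete tiling. -/
theorem hasOpenConnection_of_stages {e : ℕ → Placement}
    (h : ∀ n, ∀ m ≤ n, HasOpenConnection (e '' Iic n) (e m)) (m : ℕ) :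
    HasOpenConnection (range e) (e m) := by
  by_contra hno
  have hall : ∀ x ∈ e m '' connections, ∃ n, e n ≠ e m ∧ x ∈ e n '' decoration := by
    intro x hx
    by_contra hx'
    push Not at hx'
    refine hno ⟨x, hx, ?_⟩
    rintro _ ⟨n, rfl⟩ hne
    exact hx' n hne
  choose! f hf using hall
  have hfin : (f '' (e m '' connections)).Finite := by
    refine Finite.image _ (Finite.image _ ?_)
    simp [connections]
  -- If all three connections were blocked in the end, the blocking tiles would all be present at a
  -- finite stage, contradicting R2 at that stage.
  obtain ⟨N, hN⟩ := hfin.bddAbove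
  obtain ⟨x, hx, hx'⟩ := h (max N m) m (le_max_right _ _)
  exact hx' (e (f x))
    (mem_image_of_mem e (le_trans (hN (mem_image_of_mem f hx)) (le_max_left _ _)))
    (hf x hx).1 (hf x hx).2

/-- A tile with an open connection is connected to at most two other tiles. -/
theorem at_most_two_neighbours {𝒯 : Set Placement} (ht : IsTiling 𝒯) {g a b c : Placement}
    (hg : g ∈ 𝒯) (ha : a ∈ 𝒯) (hb : b ∈ 𝒯) (hc : c ∈ 𝒯) (hopen : HasOpenConnection 𝒯 g)
    (hga : g ≠ a) (hgb : g ≠ b) (hgc : g ≠ c)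
    (ma : (g '' decoration ∩ a '' decoration).Nonempty)
    (mb : (g '' decoration ∩ b '' decoration).Nonempty)
    (mc : (g '' decoration ∩ c '' decoration).Nonempty) : a = b ∨ a = c ∨ b = c := by
  by_contra hne
  push Not at hne
  obtain ⟨hab, hac, hbc⟩ := hne
  obtain ⟨y, hy, hyo⟩ := hopen
  have hmeet : ∀ h ∈ 𝒯, g ≠ h → (g '' decoration ∩ h '' decoration).Nonempty →
      ∃ x ∈ connections, g x ∈ h '' connections ∧ g x ≠ y := by
    rintro h hh hgh ⟨x, hx1, hx2⟩
    obtain ⟨p, hp, rfl⟩ := mem_connections_of_mem_decoration (ht.2 hg hh hgh) hx1 hx2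
    refine ⟨p, hp, mem_connections_of_mem_decoration (ht.2 hh hg hgh.symm) hx2 hx1, ?_⟩
    rintro rfl
    exact hyo h hh hgh.symm hx2
  obtain ⟨y, hy', rfl⟩ := hy
  obtain ⟨p, hp, hpa, hpy⟩ := hmeet a ha hga ma
  obtain ⟨q, hq, hqb, hqy⟩ := hmeet b hb hgb mb
  obtain ⟨r, hr, hrc, hry⟩ := hmeet c hc hgc mc
  have hpq : p ≠ q := by
    rintro rfl
    exact not_three_connections (ht.2 hg ha hga) (ht.2 hg hb hgb) (ht.2 ha hb hab)
      (mem_image_of_mem g hp) hpa hqb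
  have hpr : p ≠ r := by
    rintro rfl
    exact not_three_connections (ht.2 hg ha hga) (ht.2 hg hc hgc) (ht.2 ha hc hac)
      (mem_image_of_mem g hp) hpa hrc
  have hqr : q ≠ r := by
    rintro rfl
    exact not_three_connections (ht.2 hg hb hgb) (ht.2 hg hc hgc) (ht.2 hb hc hbc)
      (mem_image_of_mem g hq) hqb hrc
  have hpy' : p ≠ y := fun h => hpy (by rw [h])
  have hqy' : q ≠ y := fun h => hqy (by rw [h])
  have hry' : r ≠ y := fun h => hry (by rw [h])
  simp only [connections, mem_insert_iff, mem_singleton_iff] at hp hq hr hy'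
  -- Pigeonhole: `p`, `q`, `r` and the open connection would be four distinct members of a
  -- three-element set.
  generalize (!₂[(0 : ℝ), 1] : Plane) = A at *
  generalize (!₂[(3 : ℝ), 1] : Plane) = B at *
  generalize (!₂[(1 : ℝ), 0] : Plane) = D at *
  grind

/-- The plane is not a union of finitely many tiles and their translates by the multiples of one
vector. -/
theorem not_cover_of_finite_orbits {ι : Type*} (A : ι → Set Plane) (T : Equiv.Perm ι) (w : Plane)
    (hw : w ≠ 0) (hT : ∀ n, A (T n) = (fun x => w + x) '' A n)
    (hb : ∀ n, Bornology.IsBounded (A n)) (F : Set ι) (hF : F.Finite)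
    (horb : ∀ n, ∃ x ∈ F, ∃ k : ℤ, n = (T ^ k) x) : (⋃ n, A n) ≠ univ := by
  intro hcov
  -- A linear functional that vanishes on `w` is constant along orbits of points, so its bound on
  -- finitely many tiles would hold on the whole plane.
  let f : Plane → ℝ := fun x => -w 1 * x 0 + w 0 * x 1
  have hfw : ∀ x, f (w + x) = f x := fun x => by simp [f]; ring
  have hbd : Bornology.IsBounded (⋃ n ∈ F, A n) :=
    (Bornology.isBounded_biUnion hF).2 fun n _ => hb n
  obtain ⟨R, hR⟩ := hbd.exists_norm_le
  obtain ⟨B, hB⟩ : ∃ B : ℝ, ∀ n ∈ F, ∀ x ∈ A n, f x ≤ B := by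
    refine ⟨|w 1| * R + |w 0| * R, fun n hn x hx => ?_⟩
    have hxR := hR x (mem_biUnion hn hx)
    have h0 : |x 0| ≤ R := (PiLp.norm_apply_le x 0).trans hxR
    have h1 : |x 1| ≤ R := (PiLp.norm_apply_le x 1).trans hxR
    refine add_le_add ?_ ?_
    · refine (le_abs_self _).trans ?_
      rw [abs_mul, abs_neg]
      gcongr
    · refine (le_abs_self _).trans ?_
      rw [abs_mul]
      gcongr
  have hstep : ∀ n, (∀ x ∈ A (T n), f x ≤ B) ↔ ∀ x ∈ A n, f x ≤ B := by
    intro n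
    rw [hT, forall_mem_image]
    simp only [hfw]
  have hz : ∀ (k : ℤ) n, (∀ x ∈ A ((T ^ k) n), f x ≤ B) ↔ ∀ x ∈ A n, f x ≤ B := by
    intro k
    induction k using Int.induction_on with
    | zero => simp
    | succ m ih =>
      intro n
      rw [add_comm, zpow_add, zpow_one, Equiv.Perm.mul_apply, hstep, ih]
    | pred m ih =>
      intro n
      rw [← hstep, ← Equiv.Perm.mul_apply, ← zpow_one_add, add_sub_cancel, ih]
  have hall : ∀ x, f x ≤ B := by
    intro x
    obtain ⟨n, hn⟩ := mem_iUnion.1 (hcov ▸ mem_univ x : x ∈ ⋃ n, A n)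
    obtain ⟨m, hm, k, rfl⟩ := horb n
    exact (hz k m).2 (hB m hm) x hn
  have hpos : 0 < w 0 ^ 2 + w 1 ^ 2 := by
    by_contra hle
    refine hw (plane_ext ?_ ?_)
    · show w 0 = 0
      nlinarith [sq_nonneg (w 0), sq_nonneg (w 1)]
    · show w 1 = 0
      nlinarith [sq_nonneg (w 0), sq_nonneg (w 1)]
  have := hall (((|B| + 1) / (w 0 ^ 2 + w 1 ^ 2)) • !₂[-w 1, w 0])
  have hval : f (((|B| + 1) / (w 0 ^ 2 + w 1 ^ 2)) • !₂[-w 1, w 0]) = |B| + 1 := by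
    simp [f]
    field_simp
    ring
  rw [hval] at this
  linarith [le_abs_self B]

/-- At a point of `S` maximising the inner product with `u`, translation by `u` would increase the
maximum by `‖u‖²`. -/
theorem image_add_ne_self {S : Set Plane} (hS : IsCompact S) (hne : S.Nonempty) {u : Plane}
    (hu : u ≠ 0) : (fun x => u + x) '' S ≠ S := by
  intro he
  obtain ⟨x, hx, hmax⟩ := hS.exists_isMaxOn hne
    (f := fun x => inner ℝ u x) (Continuous.continuousOn (by fun_prop))
  have h1 : u + x ∈ S := he ▸ mem_image_of_mem _ hx
  have h2 : inner ℝ u (u + x) ≤ inner ℝ u x := hmax h1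
  rw [inner_add_right, real_inner_self_eq_norm_sq] at h2
  have : 0 < ‖u‖ ^ 2 := by positivity
  linarith

theorem isCompact_squareTile : IsCompact squareTile := by
  refine Metric.isCompact_of_isClosed_isBounded ?_ ?_
  · have h : squareTile = (EuclideanSpace.proj 0 : Plane →L[ℝ] ℝ) ⁻¹' Icc 0 3 ∩
        (EuclideanSpace.proj 1 : Plane →L[ℝ] ℝ) ⁻¹' Icc 0 3 := by
      ext p; simp [squareTile, and_assoc]
    rw [h]
    exact (isClosed_Icc.preimage (ContinuousLinearMap.continuous _)).inter
      (isClosed_Icc.preimage (ContinuousLinearMap.continuous _))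
  · refine isBounded_iff_forall_norm_le.2 ⟨5, ?_⟩
    rintro p ⟨h1, h2, h3, h4⟩
    rw [EuclideanSpace.norm_eq, Fin.sum_univ_two, Real.sqrt_le_left (by norm_num)]
    simp only [Real.norm_eq_abs, sq_abs]
    nlinarith

theorem isNonperiodic_of_generatedByR2 {𝒯 : Set Placement} (ht : IsTiling 𝒯)
    (hr : GeneratedByR2 𝒯) : IsNonperiodic 𝒯 := by
  obtain ⟨e, hinj, rfl, hconn, hopen⟩ := hr
  intro w hw hper
  have hmem : ∀ n, e n ∈ range e := mem_range_self
  have hcpt : ∀ n, IsCompact (e n '' squareTile) := fun n =>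
    isCompact_squareTile.image (e n).continuous
  have hne : ∀ n, (e n '' squareTile).Nonempty := fun n =>
    (interior_squareTile_nonempty.mono interior_subset).image _
  have hsq : ∀ m n, e m '' squareTile = e n '' squareTile → m = n := fun m n h =>
    hinj (image_squareTile_injOn ht (hmem m) (hmem n) h)
  have hfwd : ∀ n, ∃ m, e m '' squareTile = (fun x => w + x) '' (e n '' squareTile) ∧
      e m '' decoration = (fun x => w + x) '' (e n '' decoration) := by
    intro n
    have h := hper.subset (mem_image_of_mem _ (mem_image_of_mem _ (hmem n)))
    obtain ⟨_, ⟨m, rfl⟩, hm⟩ := h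
    exact ⟨m, (Prod.ext_iff.1 hm).1, (Prod.ext_iff.1 hm).2⟩
  choose t ht1 ht2 using hfwd
  have hsurj : Function.Surjective t := by
    intro m
    have h := hper.superset (mem_image_of_mem _ (hmem m))
    obtain ⟨_, ⟨_, ⟨n, rfl⟩, rfl⟩, hn⟩ := h
    refine ⟨n, hsq _ _ ?_⟩
    rw [ht1]
    exact (Prod.ext_iff.1 hn).1
  have hinjt : Function.Injective t := by
    intro m n h
    refine hsq _ _ ((image_injective.2 (add_right_injective w)) ?_)
    rw [← ht1, ← ht1, h]
  let T : Equiv.Perm ℕ := Equiv.ofBijective t ⟨hinjt, hsurj⟩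
  let G : SimpleGraph ℕ :=
    { Adj := fun m n => m ≠ n ∧ (e m '' decoration ∩ e n '' decoration).Nonempty
      symm := ⟨fun m n h => ⟨h.1.symm, by rw [inter_comm]; exact h.2⟩⟩
      loopless := ⟨fun m h => h.1 rfl⟩ }
  have hreach : ∀ n, G.Reachable n 0 := by
    intro n
    induction n using Nat.strong_induction_on with
    | _ n ih =>
      rcases Nat.eq_zero_or_pos n with rfl | hn
      · exact SimpleGraph.Reachable.refl _
      · obtain ⟨m, hm, hmn⟩ := hconn n hn
        have : G.Adj n m := ⟨hm.ne', hmn⟩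
        exact this.reachable.trans (ih m hm)
  have hG : G.Connected := ⟨fun m n => (hreach m).trans (hreach n).symm⟩
  obtain ⟨F, hF, horb⟩ := exists_finite_orbit_representatives G hG
    (fun v a b c ha hb hc => by
      rcases at_most_two_neighbours ht (hmem v) (hmem a) (hmem b) (hmem c)
        (hasOpenConnection_of_stages hopen v) (hinj.ne ha.1) (hinj.ne hb.1) (hinj.ne hc.1)
        ha.2 hb.2 hc.2 with h | h | h
      · exact Or.inl (hinj h)
      · exact Or.inr (Or.inl (hinj h))
      · exact Or.inr (Or.inr (hinj h)))
    T
    (fun a b => by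
      refine and_congr hinjt.ne_iff ?_
      change (e (t a) '' decoration ∩ e (t b) '' decoration).Nonempty ↔ _
      rw [ht2, ht2, ← image_inter (add_right_injective w), image_nonempty])
    (fun v h => image_add_ne_self (hcpt v) (hne v) hw (by
      rw [← ht1]; exact congrArg (fun n => e n '' squareTile) h))
    (fun v h => image_add_ne_self (u := w + w) (hcpt v) (hne v)
      (by rw [← two_smul ℝ w]; simpa using hw) (by
        have h2 : e (t (t v)) '' squareTile = e v '' squareTile :=
          congrArg (fun n => e n '' squareTile) h
        rw [ht1, ht1, image_image] at h2
        simpa only [add_assoc] using h2))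
  refine not_cover_of_finite_orbits (fun n => e n '' squareTile) T w hw ht1
    (fun n => (hcpt n).isBounded) F hF horb ?_
  simpa [biUnion_range] using ht.1

/-! ### The Hilbert polygon -/

/-- The four orientations of the sections of the Hilbert polygon: `(σ, ε)` stands for the linear
map that swaps the coordinates if `σ` holds, and changes both signs if `ε` holds. -/
abbrev Orientation : Type := Bool × Bool

/-- The `r`-th cell, in a `2 × 2` array of cells, of the Hilbert polygon of order one with the
given orientation. -/
def subcell (t : Orientation) (r : ℕ) : ℤ × ℤ :=
  let p : ℤ × ℤ := match r with
    | 0 => (0, 0)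
    | 1 => (0, 1)
    | 2 => (1, 1)
    | _ => (1, 0)
  let q := if t.1 then (p.2, p.1) else p
  if t.2 then (1 - q.1, 1 - q.2) else q

/-- The orientation of the `r`-th cell in a section of order one with the given orientation. -/
def suborientation (t : Orientation) (r : ℕ) : Orientation :=
  match r with
  | 0 => (!t.1, t.2)
  | 1 => t
  | 2 => t
  | _ => (!t.1, !t.2)

/-- The orientation of the `i`-th cell of the Hilbert polygon of order `n`. -/
def orientation : ℕ → ℕ → Orientation
  | 0, _ => (false, false)
  | n + 1, i => suborientation (orientation n (i % 4 ^ n)) (i / 4 ^ n)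

theorem orientation_succ (n i : ℕ) :
    orientation (n + 1) i = suborientation (orientation n (i % 4 ^ n)) (i / 4 ^ n) := rfl

theorem div_cases {i n : ℕ} (h : i < 4 ^ (n + 1)) :
    i / 4 ^ n = 0 ∨ i / 4 ^ n = 1 ∨ i / 4 ^ n = 2 ∨ i / 4 ^ n = 3 := by
  have : i / 4 ^ n < 4 := by
    rw [Nat.div_lt_iff_lt_mul (by positivity)]
    rw [pow_succ] at h
    omega
  generalize i / 4 ^ n = q at *
  omega

/-- In base 4, the recursion for `hilbert` reads the leading digit and refinement appends a last
digit; the two operations do not interfere. -/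
theorem refine_digits (n k r : ℕ) (hr : r < 4) :
    (4 * k + r) / 4 ^ (n + 1) = k / 4 ^ n ∧
      (4 * k + r) % 4 ^ (n + 1) = 4 * (k % 4 ^ n) + r := by
  have h1 : (4 * k + r) / 4 ^ (n + 1) = k / 4 ^ n := by
    rw [pow_succ', ← Nat.div_div_eq_div_mul]
    congr 1
    omega
  refine ⟨h1, ?_⟩
  have h2 := Nat.div_add_mod (4 * k + r) (4 ^ (n + 1))
  have h3 := Nat.div_add_mod k (4 ^ n)
  rw [h1] at h2
  rw [pow_succ'] at h2 ⊢
  rw [mul_assoc] at h2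
  omega

/-- Refinement of the Hilbert polygon: every cell is replaced by a section of order one. -/
theorem hilbert_refine (n k r : ℕ) (hr : r < 4) (hk : k < 4 ^ n) :
    hilbert (n + 1) (4 * k + r) =
        (2 * (hilbert n k).1 + (subcell (orientation n k) r).1,
          2 * (hilbert n k).2 + (subcell (orientation n k) r).2) ∧
      orientation (n + 1) (4 * k + r) = suborientation (orientation n k) r := by
  induction n generalizing k with
  | zero =>
    have : k = 0 := by simpa using hk
    subst this
    interval_cases r <;> simp [hilbert, orientation, subcell, suborientation]
  | succ n ih =>
    -- What remains is that each quadrant map carries oriented blocks to oriented blocks: a check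
    -- over four quadrants, four last digits and four orientations.
    obtain ⟨e1, e2⟩ := refine_digits n k r hr
    obtain ⟨i1, i2⟩ := ih (k % 4 ^ n) (Nat.mod_lt _ (by positivity))
    rw [hilbert, orientation_succ (n + 1), e1, e2, i1, i2, hilbert, orientation_succ n]
    generalize hilbert n (k % 4 ^ n) = p
    generalize orientation n (k % 4 ^ n) = t
    obtain ⟨x, y⟩ := p
    obtain ⟨σ, ε⟩ := t
    rcases div_cases hk with h | h | h | h <;> rw [h] <;> interval_cases r <;>
      cases σ <;> cases ε <;> simp [subcell, suborientation, pow_succ] <;> ring_nf <;> simp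

theorem subcell_bounds (t : Orientation) {r : ℕ} (hr : r < 4) :
    (0 ≤ (subcell t r).1 ∧ (subcell t r).1 ≤ 1) ∧ 0 ≤ (subcell t r).2 ∧ (subcell t r).2 ≤ 1 := by
  revert t r
  decide

theorem hilbert_injOn (n : ℕ) {i j : ℕ} (hi : i < 4 ^ n) (hj : j < 4 ^ n)
    (h : hilbert n i = hilbert n j) : i = j := by
  induction n generalizing i j with
  | zero => simp at hi hj; omega
  | succ n ih =>
    rw [pow_succ] at hi hj
    have ei : i = 4 * (i / 4) + i % 4 := by omega
    have ej : j = 4 * (j / 4) + j % 4 := by omega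
    have hri : i % 4 < 4 := by omega
    have hrj : j % 4 < 4 := by omega
    rw [ei, ej, (hilbert_refine n _ _ hri (by omega)).1,
      (hilbert_refine n _ _ hrj (by omega)).1, Prod.mk.injEq] at h
    have b1 := subcell_bounds (orientation n (i / 4)) hri
    have b2 := subcell_bounds (orientation n (j / 4)) hrj
    have hq : i / 4 = j / 4 := ih (by omega) (by omega) (Prod.ext (by omega) (by omega))
    have key2 : ∀ (t : Orientation) r, r < 4 → ∀ s, s < 4 →
        (subcell t r).1 = (subcell t s).1 → (subcell t r).2 = (subcell t s).2 → r = s := by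
      decide
    rw [hq] at h
    have := key2 (orientation n (j / 4)) _ hri _ hrj (by omega) (by omega)
    omega

theorem hilbert_surjOn (n : ℕ) {x y : ℤ} (hx : 0 ≤ x) (hx' : x < 2 ^ n) (hy : 0 ≤ y)
    (hy' : y < 2 ^ n) : ∃ i < 4 ^ n, hilbert n i = (x, y) := by
  induction n generalizing x y with
  | zero =>
    refine ⟨0, by simp, ?_⟩
    simp at hx' hy'
    simp [hilbert]
    omega
  | succ n ih =>
    rw [pow_succ] at hx' hy'
    obtain ⟨k, hk, he⟩ := ih (x := x / 2) (y := y / 2) (by omega) (by omega) (by omega) (by omega)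
    have key : ∀ (t : Orientation) (a b : Bool), ∃ r < 4,
        subcell t r = (if a then 1 else 0, if b then 1 else 0) := by
      decide
    -- Halving the coordinates selects the coarse cell; their parities select the place in its
    -- block.
    obtain ⟨r, hr, hs⟩ := key (orientation n k) (decide (x % 2 = 1)) (decide (y % 2 = 1))
    refine ⟨4 * k + r, by rw [pow_succ]; omega, ?_⟩
    rw [(hilbert_refine n k r hr hk).1, hs, he]
    simp only [decide_eq_true_eq]
    refine Prod.ext ?_ ?_ <;> dsimp only <;> split_ifs <;> omega

/-- The unit vectors of the lattice. -/
def IsDir (w : ℤ × ℤ) : Prop :=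
  w = (1, 0) ∨ w = (-1, 0) ∨ w = (0, 1) ∨ w = (0, -1)

instance (w : ℤ × ℤ) : Decidable (IsDir w) := by unfold IsDir; infer_instance

theorem hilbert_zero (n : ℕ) : hilbert n 0 = (0, 0) := by
  induction n with
  | zero => rfl
  | succ n ih => simp [hilbert, ih]

theorem hilbert_last (n : ℕ) : hilbert n (4 ^ n - 1) = (2 ^ n - 1, 0) := by
  induction n with
  | zero => rfl
  | succ n ih =>
    have h0 : 0 < 4 ^ n := by positivity
    have h1 : (4 ^ (n + 1) - 1) / 4 ^ n = 3 := by
      rw [pow_succ]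
      exact Nat.div_eq_of_lt_le (by omega) (by omega)
    have h2 : (4 ^ (n + 1) - 1) % 4 ^ n = 4 ^ n - 1 := by
      have := Nat.div_add_mod (4 ^ (n + 1) - 1) (4 ^ n)
      rw [h1] at this
      rw [pow_succ] at this ⊢
      omega
    rw [hilbert, h1, h2, ih]
    simp [pow_succ]
    ring

/-- The map that places the `q`-th section of order `n` in the Hilbert polygon of order `n + 1`. -/
def quadrant (n q : ℕ) (p : ℤ × ℤ) : ℤ × ℤ :=
  match q with
  | 0 => (p.2, p.1)
  | 1 => (p.1, p.2 + 2 ^ n)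
  | 2 => (p.1 + 2 ^ n, p.2 + 2 ^ n)
  | _ => (2 * 2 ^ n - 1 - p.2, 2 ^ n - 1 - p.1)

theorem hilbert_succ (n q i : ℕ) (hi : i < 4 ^ n) :
    hilbert (n + 1) (q * 4 ^ n + i) = quadrant n q (hilbert n i) := by
  have h1 : (q * 4 ^ n + i) / 4 ^ n = q := by
    rw [add_comm, Nat.add_mul_div_right _ _ (by positivity), Nat.div_eq_of_lt hi, zero_add]
  have h2 : (q * 4 ^ n + i) % 4 ^ n = i := by
    rw [add_comm, Nat.add_mul_mod_self_right, Nat.mod_eq_of_lt hi]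
  rw [hilbert, h1, h2]
  rfl

/-- Consecutive cells of the Hilbert polygon are adjacent. -/
theorem hilbert_step (n i : ℕ) (hi : i + 1 < 4 ^ n) :
    IsDir (hilbert n (i + 1) - hilbert n i) := by
  induction n generalizing i with
  | zero => simp at hi
  | succ n ih =>
    have hpos : 0 < 4 ^ n := by positivity
    have e := Nat.div_add_mod i (4 ^ n)
    have hm := Nat.mod_lt i hpos
    rw [mul_comm] at e
    generalize i / 4 ^ n = q at *
    generalize i % 4 ^ n = j at *
    subst e
    rw [pow_succ] at hi
    have hq : q < 4 := by
      by_contra hge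
      have : 4 * 4 ^ n ≤ q * 4 ^ n := Nat.mul_le_mul_right _ (by omega)
      omega
    rcases Nat.lt_or_ge (j + 1) (4 ^ n) with h | h
    · have := ih j h
      rw [add_assoc, hilbert_succ n q j hm, hilbert_succ n q (j + 1) h]
      generalize hilbert n (j + 1) = a at *
      generalize hilbert n j = b at *
      obtain ⟨a1, a2⟩ := a
      obtain ⟨b1, b2⟩ := b
      simp only [IsDir, Prod.mk_sub_mk, Prod.mk.injEq] at this
      interval_cases q <;> simp only [quadrant, IsDir, Prod.mk_sub_mk, Prod.mk.injEq] <;> omega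
    -- The step passes from the end of one quadrant to the start of the next.
    · have hj : j = 4 ^ n - 1 := by omega
      have hj' : q * 4 ^ n + j + 1 = (q + 1) * 4 ^ n + 0 := by
        rw [add_mul]; omega
      have hq' : q < 3 := by
        by_contra hge
        have : q = 3 := by omega
        subst this
        omega
      rw [hj', hilbert_succ n q j hm, hilbert_succ n (q + 1) 0 hpos, hj, hilbert_zero,
        hilbert_last]
      interval_cases q <;> simp only [quadrant, IsDir, Prod.mk_sub_mk, Prod.mk.injEq] <;> omega


/-! ### Facing blocks and the absence of adjacent parallel steps in the same direction. -/

set_option synthInstance.maxSize 2000 in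
set_option synthInstance.maxHeartbeats 200000 in
/-- In the Hilbert polygon, cells have the orientation swap exactly if their right neighbours have
the opposite orientation, and the analogue for upper neighbours. -/
theorem orientation_neighbours (n : ℕ) {i j : ℕ} (hi : i < 4 ^ n) (hj : j < 4 ^ n) :
    (hilbert n j = hilbert n i + (1, 0) →
      (orientation n i = (true, false) ↔ orientation n j = (true, true))) ∧
    (hilbert n j = hilbert n i + (0, 1) →
      (orientation n i = (false, false) ↔ orientation n j = (false, true))) := by
  -- The orientation tells along which side of a 2 × 2 block its middle step runs: top for `(false,
  -- false)`, right for `(true, false)`, bottom for `(false, true)`, left for `(true, true)`. So the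
  -- claim is that a middle step runs along one face of a common side exactly if one runs along the
  -- other face.
  induction n generalizing i j with
  | zero =>
    have e : hilbert 0 j = hilbert 0 i := rfl
    simp [e]
  | succ n ih =>
    rw [pow_succ] at hi hj
    obtain ⟨ei, oi⟩ := hilbert_refine n (i / 4) (i % 4) (by omega) (by omega)
    obtain ⟨ej, oj⟩ := hilbert_refine n (j / 4) (j % 4) (by omega) (by omega)
    rw [Nat.div_add_mod] at ei ej oi oj
    have hri : i % 4 < 4 := by omega
    have hrj : j % 4 < 4 := by omega
    have hinj := hilbert_injOn n (i := i / 4) (j := j / 4) (by omega) (by omega)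
    obtain ⟨ih1, ih2⟩ := ih (i := i / 4) (j := j / 4) (by omega) (by omega)
    rw [ei, ej, oi, oj]
    have hor : hilbert n (i / 4) = hilbert n (j / 4) →
        orientation n (i / 4) = orientation n (j / 4) := fun h => by rw [hinj h]
    clear hinj ei ej oi oj ih hi hj
    generalize hilbert n (i / 4) = p at *
    generalize hilbert n (j / 4) = q at *
    generalize orientation n (i / 4) = s at *
    generalize orientation n (j / 4) = t at *
    generalize i % 4 = a at *
    generalize j % 4 = b at *
    obtain ⟨p1, p2⟩ := p
    obtain ⟨q1, q2⟩ := q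
    simp only [Prod.mk_add_mk, Prod.mk.injEq, add_zero] at *
    -- either the cells belong to the same section, or their sections are neighbours
    have ka := subcell_bounds s hri
    have kb := subcell_bounds t hrj
    have same1 : ∀ (s : Orientation) (a : ℕ), a < 4 → ∀ b < 4,
        (subcell s b).1 = (subcell s a).1 + 1 → (subcell s b).2 = (subcell s a).2 →
        (suborientation s a = (true, false) ↔ suborientation s b = (true, true)) := by decide
    have same2 : ∀ (s : Orientation) (a : ℕ), a < 4 → ∀ b < 4,
        (subcell s b).1 = (subcell s a).1 → (subcell s b).2 = (subcell s a).2 + 1 →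
        (suborientation s a = (false, false) ↔ suborientation s b = (false, true)) := by decide
    have diff1 : ∀ (s t : Orientation) (a : ℕ), a < 4 → ∀ b < 4,
        (subcell s a).1 = 1 → (subcell t b).1 = 0 → (subcell t b).2 = (subcell s a).2 →
        (s = (true, false) ↔ t = (true, true)) →
        (suborientation s a = (true, false) ↔ suborientation t b = (true, true)) := by decide
    have diff2 : ∀ (s t : Orientation) (a : ℕ), a < 4 → ∀ b < 4,
        (subcell s a).2 = 1 → (subcell t b).2 = 0 → (subcell t b).1 = (subcell s a).1 →
        (s = (false, false) ↔ t = (false, true)) →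
        (suborientation s a = (false, false) ↔ suborientation t b = (false, true)) := by decide
    refine ⟨fun ⟨h1, h2⟩ => ?_, fun ⟨h1, h2⟩ => ?_⟩
    · rcases eq_or_ne p1 q1 with h | h
      · have := hor ⟨h, by omega⟩
        subst this
        exact same1 s a hri b hrj (by omega) (by omega)
      · exact diff1 s t a hri b hrj (by omega) (by omega) (by omega) (ih1 ⟨by omega, by omega⟩)
    · rcases eq_or_ne p2 q2 with h | h
      · have := hor ⟨by omega, h⟩
        subst this
        exact same2 s a hri b hrj (by omega) (by omega)
      · exact diff2 s t a hri b hrj (by omega) (by omega) (by omega) (ih2 ⟨by omega, by omega⟩)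

/-- The coordinate sum of the `i`-th cell of the Hilbert polygon has the parity of `i`. -/
theorem hilbert_parity (n i : ℕ) (hi : i < 4 ^ n) :
    ((hilbert n i).1 + (hilbert n i).2) % 2 = (i : ℤ) % 2 := by
  cases n with
  | zero =>
    have : i = 0 := by simpa using hi
    subst this
    simp [hilbert]
  | succ n =>
    rw [pow_succ] at hi
    obtain ⟨ei, -⟩ := hilbert_refine n (i / 4) (i % 4) (by omega) (by omega)
    rw [Nat.div_add_mod] at ei
    have key : ∀ (s : Orientation) (a : ℕ), a < 4 →
        ((subcell s a).1 + (subcell s a).2) % 2 = (a : ℤ) % 2 := by decide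
    have := key (orientation n (i / 4)) (i % 4) (by omega)
    rw [ei]
    dsimp only
    omega

-- Adjacent cells have indices of opposite parity, so `j` is even and step `j` is the first or last
-- step inside a block. Step `i` is the middle step of a block or joins two blocks. A middle step is
-- opposed either by the unjoined side of its own block or, by `orientation_neighbours`, by another
-- middle step; a joining step crosses a block boundary, and so would its translate.
set_option synthInstance.maxSize 2000 in
set_option synthInstance.maxHeartbeats 200000 in
theorem hilbert_no_parallel_of_odd (n : ℕ) {i j : ℕ} (hi : i + 1 < 4 ^ n) (hj : j + 1 < 4 ^ n)
    (hodd : i % 2 = 1) {d : ℤ × ℤ} (hd : IsDir d)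
    (h1 : hilbert n j = hilbert n i + d) (h2 : hilbert n (j + 1) = hilbert n (i + 1) + d)
    (hperp : d.1 * (hilbert n (i + 1) - hilbert n i).1 +
      d.2 * (hilbert n (i + 1) - hilbert n i).2 = 0) : False := by
  cases n with
  | zero => simp at hi
  | succ n =>
    have hpar : j % 2 = 0 := by
      have p1 := hilbert_parity (n + 1) i (by omega)
      have p2 := hilbert_parity (n + 1) j (by omega)
      rw [h1] at p2
      rcases hd with rfl | rfl | rfl | rfl <;> simp at p2 <;> omega
    rw [pow_succ] at hi hj
    obtain ⟨k, a, ha, rfl⟩ : ∃ k a, (a = 1 ∨ a = 3) ∧ i = 4 * k + a :=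
      ⟨i / 4, i % 4, by omega, by omega⟩
    obtain ⟨l, b, hb, rfl⟩ : ∃ l b, (b = 0 ∨ b = 2) ∧ j = 4 * l + b :=
      ⟨j / 4, j % 4, by omega, by omega⟩
    rw [add_assoc (4 * l), (hilbert_refine n l (b + 1) (by omega) (by omega)).1] at h2
    rw [(hilbert_refine n l b (by omega) (by omega)).1] at h1
    rw [(hilbert_refine n k a (by omega) (by omega)).1] at h1 hperp
    have kb := subcell_bounds (orientation n l) (r := b) (by omega)
    have kb' := subcell_bounds (orientation n l) (r := b + 1) (by omega)
    have ka := subcell_bounds (orientation n k) (r := a) (by omega)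
    rcases ha with rfl | rfl
    · rw [add_assoc (4 * k), (hilbert_refine n k (1 + 1) (by omega) (by omega)).1] at h2 hperp
      have ka' := subcell_bounds (orientation n k) (r := 1 + 1) (by omega)
      have hor : hilbert n k = hilbert n l → orientation n k = orientation n l := fun h => by
        rw [hilbert_injOn n (by omega) (by omega) h]
      obtain ⟨n1, n2⟩ := orientation_neighbours n (i := k) (j := l) (by omega) (by omega)
      obtain ⟨n3, n4⟩ := orientation_neighbours n (i := l) (j := k) (by omega) (by omega)
      generalize hilbert n k = p at *
      generalize hilbert n l = q at *
      generalize orientation n k = s at *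
      generalize orientation n l = t at *
      clear hi hj hodd hpar
      -- Only the displacement `e` of the two blocks matters. It is zero or a unit vector, and the
      -- last five clauses record what is then known about the orientations.
      have key : ∀ (s t : Orientation) (b : ℕ), b < 3 → b % 2 = 0 →
          ∀ d ∈ [((1, 0) : ℤ × ℤ), (-1, 0), (0, 1), (0, -1)],
          ∀ e ∈ [((0, 0) : ℤ × ℤ), (1, 0), (-1, 0), (0, 1), (0, -1)],
          ¬((2 * e.1 + (subcell t b).1 = (subcell s 1).1 + d.1 ∧
            2 * e.2 + (subcell t b).2 = (subcell s 1).2 + d.2 ∧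
            2 * e.1 + (subcell t (b + 1)).1 = (subcell s (1 + 1)).1 + d.1 ∧
            2 * e.2 + (subcell t (b + 1)).2 = (subcell s (1 + 1)).2 + d.2 ∧
            d.1 * ((subcell s (1 + 1)).1 - (subcell s 1).1) +
              d.2 * ((subcell s (1 + 1)).2 - (subcell s 1).2) = 0) ∧
          (e = (0, 0) → s = t) ∧
          (e = (1, 0) → (s = (true, false) ↔ t = (true, true))) ∧
          (e = (0, 1) → (s = (false, false) ↔ t = (false, true))) ∧
          (e = (-1, 0) → (t = (true, false) ↔ s = (true, true))) ∧
          (e = (0, -1) → (t = (false, false) ↔ s = (false, true)))) := by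
        decide
      obtain ⟨p1, p2⟩ := p
      obtain ⟨q1, q2⟩ := q
      obtain ⟨d1, d2⟩ := d
      simp only [Prod.mk_add_mk, Prod.mk_sub_mk, Prod.mk.injEq, add_zero, IsDir] at *
      refine key s t b (by omega) (by omega) (d1, d2) ?_ (q1 - p1, q2 - p2) ?_
        ⟨⟨by dsimp only; omega, by dsimp only; omega, by dsimp only; omega,
          by dsimp only; omega, ?_⟩, fun h => ?_, fun h => ?_, fun h => ?_, fun h => ?_,
          fun h => ?_⟩
      · simpa using hd
      · simp only [List.mem_cons, Prod.mk.injEq, List.not_mem_nil, or_false]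
        omega
      · rw [← hperp]
        ring
      · rw [Prod.mk.injEq] at h
        exact hor (by omega)
      · rw [Prod.mk.injEq] at h
        exact n1 (by omega)
      · rw [Prod.mk.injEq] at h
        exact n2 (by omega)
      · rw [Prod.mk.injEq] at h
        exact n3 (by omega)
      · rw [Prod.mk.injEq] at h
        exact n4 (by omega)
    -- A joining step: its perpendicular translate crosses the same grid line between blocks,
    -- whereas step `j` stays in block `l`.
    · have hk : 4 * k + 3 + 1 = 4 * (k + 1) + 0 := by ring
      rw [hk, (hilbert_refine n (k + 1) 0 (by omega) (by omega)).1] at h2 hperp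
      have ka' := subcell_bounds (orientation n (k + 1)) (r := 0) (by omega)
      have hne : hilbert n k ≠ hilbert n (k + 1) := fun h => by
        have := hilbert_injOn n (by omega) (by omega) h
        omega
      generalize hilbert n k = p at *
      generalize hilbert n (k + 1) = p' at *
      generalize hilbert n l = q at *
      obtain ⟨p1, p2⟩ := p
      obtain ⟨p1', p2'⟩ := p'
      obtain ⟨q1, q2⟩ := q
      simp only [ne_eq, Prod.mk.injEq] at hne
      rcases hd with rfl | rfl | rfl | rfl <;>
        simp only [Prod.mk_add_mk, Prod.mk_sub_mk, Prod.mk.injEq, add_zero] at h1 h2 hperp <;>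
        omega

/-- Adjacent parallel steps of the Hilbert polygon never have the same direction. -/
theorem hilbert_no_parallel (n : ℕ) {i j : ℕ} (hi : i + 1 < 4 ^ n) (hj : j + 1 < 4 ^ n)
    {d : ℤ × ℤ} (hd : IsDir d)
    (h1 : hilbert n j = hilbert n i + d) (h2 : hilbert n (j + 1) = hilbert n (i + 1) + d)
    (hperp : d.1 * (hilbert n (i + 1) - hilbert n i).1 +
      d.2 * (hilbert n (i + 1) - hilbert n i).2 = 0) : False := by
  rcases Nat.mod_two_eq_zero_or_one i with h | h
  · have hpar : j % 2 = 1 := by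
      have p1 := hilbert_parity n i (by omega)
      have p2 := hilbert_parity n j (by omega)
      rw [h1] at p2
      rcases hd with rfl | rfl | rfl | rfl <;> simp at p2 <;> omega
    refine hilbert_no_parallel_of_odd n hj hi hpar (d := -d) ?_ ?_ ?_ ?_
    · rcases hd with rfl | rfl | rfl | rfl <;> simp [IsDir]
    · rw [h1]; abel
    · rw [h2]; abel
    · rw [h1, h2, add_sub_add_right_eq_sub]
      simp only [Prod.fst_neg, Prod.snd_neg]
      linarith
  · exact hilbert_no_parallel_of_odd n hi hj h hd h1 h2 hperp

/-! ### A two-sided infinite Hilbert order -/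

/-- The index at which the section of order `2 * m` of the infinite order starts. -/
def sectionStart : ℕ → ℤ
  | 0 => 0
  | m + 1 => sectionStart m - 8 * 16 ^ m

/-- The lattice isometry that places the section of order `2 * m` of the infinite order, so that
it becomes the eighth one of the sixteen parts of the next section. -/
def place : ℕ → ℤ × ℤ → ℤ × ℤ
  | 0, p => p
  | m + 1, p => place m (p.2 - 2 * 4 ^ m, p.1 - 2 * 4 ^ m)

/-- A two-sided infinite Hilbert order of the cells of the plane. -/
def order (k : ℤ) : ℤ × ℤ :=
  place k.natAbs (hilbert (2 * k.natAbs) (k - sectionStart k.natAbs).toNat)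

/-- Counting from 0, part 8 is the first quarter of the third quadrant. It has parts before and
after it in time and a positive margin on all four sides of the square, so iterating exhausts both
the integers and the plane. -/
theorem hilbert_eighth_part (m i : ℕ) (hi : i < 16 ^ m) :
    hilbert (2 * (m + 1)) (8 * 16 ^ m + i) =
      ((hilbert (2 * m) i).2 + 2 * 4 ^ m, (hilbert (2 * m) i).1 + 2 * 4 ^ m) := by
  have e : (4 : ℕ) ^ (2 * m) = 16 ^ m := by rw [pow_mul]; norm_num
  have e' : (2 : ℤ) ^ (2 * m) = 4 ^ m := by rw [pow_mul]; norm_num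
  have h1 := hilbert_succ (2 * m + 1) 2 i (by rw [pow_succ, e]; omega)
  have h2 := hilbert_succ (2 * m) 0 i (by rw [e]; exact hi)
  rw [zero_mul, zero_add] at h2
  rw [h2, pow_succ, e] at h1
  rw [show 2 * (m + 1) = 2 * m + 1 + 1 by ring, show 8 * 16 ^ m + i = 2 * (16 ^ m * 4) + i by ring,
    h1]
  simp only [quadrant, pow_succ, e', Prod.mk.injEq]
  constructor <;> ring

/-- The third quadrant begins with part 8, so a section of order `2 * m + 1` can start at the same
index as the section of order `2 * m`. This supplies the odd orders. -/
theorem hilbert_second_half (m i : ℕ) (hi : i < 4 ^ (2 * m + 1)) :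
    hilbert (2 * (m + 1)) (8 * 16 ^ m + i) =
      ((hilbert (2 * m + 1) i).1 + 2 * 4 ^ m, (hilbert (2 * m + 1) i).2 + 2 * 4 ^ m) := by
  have e : (4 : ℕ) ^ (2 * m) = 16 ^ m := by rw [pow_mul]; norm_num
  have e' : (2 : ℤ) ^ (2 * m) = 4 ^ m := by rw [pow_mul]; norm_num
  have h1 := hilbert_succ (2 * m + 1) 2 i hi
  rw [pow_succ, e] at h1
  rw [show 2 * (m + 1) = 2 * m + 1 + 1 by ring, show 8 * 16 ^ m + i = 2 * (16 ^ m * 4) + i by ring,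
    h1]
  simp only [quadrant, pow_succ, e', Prod.mk.injEq]
  constructor <;> ring

/-- The sections grow by at least one at both ends, so section `k.natAbs` contains `k`; this is what
makes `order` meaningful. -/
theorem sectionStart_bounds (m : ℕ) :
    sectionStart m ≤ -m ∧ (m : ℤ) < sectionStart m + 16 ^ m := by
  induction m with
  | zero => simp [sectionStart]
  | succ m ih =>
    have : (0 : ℤ) < 16 ^ m := by positivity
    simp only [sectionStart, pow_succ]
    push_cast
    constructor <;> linarith

theorem sectionStart_le {m n : ℕ} (h : m ≤ n) :
    sectionStart n ≤ sectionStart m ∧ sectionStart m + 16 ^ m ≤ sectionStart n + 16 ^ n := by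
  induction n, h using Nat.le_induction with
  | base => simp
  | succ n _ ih =>
    have : (0 : ℤ) < 16 ^ n := by positivity
    simp only [sectionStart, pow_succ]
    constructor <;> linarith

/-- `place` undoes the swap and shift of `hilbert_eighth_part`, so larger sections extend smaller
ones. -/
theorem place_hilbert_eq {m n : ℕ} (h : m ≤ n) {k : ℤ} (h1 : sectionStart m ≤ k)
    (h2 : k < sectionStart m + 16 ^ m) :
    place n (hilbert (2 * n) (k - sectionStart n).toNat) =
      place m (hilbert (2 * m) (k - sectionStart m).toNat) := by
  induction n, h using Nat.le_induction with
  | base => rfl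
  | succ n hn ih =>
    rw [← ih]
    obtain ⟨h3, h4⟩ := sectionStart_le hn
    have e : (k - sectionStart (n + 1)).toNat = 8 * 16 ^ n + (k - sectionStart n).toNat := by
      have h5 : ((8 * 16 ^ n : ℕ) : ℤ) = 8 * 16 ^ n := by push_cast; ring
      rw [sectionStart]
      omega
    have hlt : (k - sectionStart n).toNat < 16 ^ n := by
      have h5 : ((16 ^ n : ℕ) : ℤ) = 16 ^ n := by push_cast; ring
      omega
    rw [e, hilbert_eighth_part n _ hlt, place]
    simp

theorem order_eq (m : ℕ) {k : ℤ} (h1 : sectionStart m ≤ k) (h2 : k < sectionStart m + 16 ^ m) :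
    order k = place m (hilbert (2 * m) (k - sectionStart m).toNat) := by
  obtain ⟨h3, h4⟩ := sectionStart_bounds k.natAbs
  rcases le_total m k.natAbs with h | h
  · exact place_hilbert_eq h h1 h2
  · exact (place_hilbert_eq h (by omega) (by omega)).symm

theorem order_add (m : ℕ) {i : ℕ} (hi : i < 16 ^ m) :
    order (sectionStart m + i) = place m (hilbert (2 * m) i) := by
  have : ((16 ^ m : ℕ) : ℤ) = 16 ^ m := by push_cast; ring
  rw [order_eq m (by omega) (by omega), add_sub_cancel_left, Int.toNat_natCast]

/-- Any two indices lie in a common section. -/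
theorem exists_section (k l : ℤ) : ∃ (m i j : ℕ), i + 1 < 16 ^ m ∧ j + 1 < 16 ^ m ∧
    k = sectionStart m + i ∧ l = sectionStart m + j := by
  -- The additional 1 keeps the successors of `k` and `l` in the section too.
  obtain ⟨m, hm⟩ : ∃ m : ℕ, m = max k.natAbs l.natAbs + 1 := ⟨_, rfl⟩
  obtain ⟨h1, h2⟩ := sectionStart_bounds m
  have h3 : ((16 ^ m : ℕ) : ℤ) = 16 ^ m := by push_cast; ring
  exact ⟨m, (k - sectionStart m).toNat, (l - sectionStart m).toNat, by omega, by omega, by omega,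
    by omega⟩

/-- The linear part of `place` alternates between identity and coordinate swap. Steps and
perpendicularity depend on differences only, so they transfer from the finite polygons. -/
theorem place_sub (m : ℕ) :
    (∀ p q, place m p - place m q = p - q) ∨ ∀ p q, place m p - place m q = (p - q).swap := by
  induction m with
  | zero => exact Or.inl fun p q => rfl
  | succ m ih =>
    rcases ih with h | h
    · refine Or.inr fun p q => ?_
      rw [place, place, h]
      ext <;> simp
    · refine Or.inl fun p q => ?_
      rw [place, place, h]
      ext <;> simp

theorem place_injective (m : ℕ) : Function.Injective (place m) := by
  intro p q h
  rw [← sub_eq_zero] at h ⊢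
  rcases place_sub m with h' | h' <;> rw [h'] at h
  · exact h
  · exact Prod.swap_injective h

theorem isLatticeIsometry_place (m : ℕ) : IsLatticeIsometry (place m) := by
  intro p q
  rcases place_sub m with h | h
  · rw [← Prod.fst_sub, ← Prod.snd_sub, h]; simp
  · rw [← Prod.fst_sub, ← Prod.snd_sub, h]; simp; ring

/-- Each enlargement adds a margin of at least one cell on every side, so a cell lies inside the
placed square once `m` reaches `|z.1| + |z.2|`. -/
theorem exists_place_eq (z : ℤ × ℤ) (m : ℕ) : ∃ q, place m q = z ∧
    (m - |z.1| - |z.2| ≤ q.1 ∧ q.1 < |z.1| + |z.2| - m + 4 ^ m) ∧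
    (m - |z.1| - |z.2| ≤ q.2 ∧ q.2 < |z.1| + |z.2| - m + 4 ^ m) := by
  induction m with
  | zero =>
    refine ⟨z, rfl, ?_⟩
    have h1 := abs_le.1 (le_refl |z.1|)
    have h2 := abs_le.1 (le_refl |z.2|)
    have h3 := abs_nonneg z.1
    have h4 := abs_nonneg z.2
    push_cast
    omega
  | succ m ih =>
    obtain ⟨q, hq, hq1, hq2⟩ := ih
    refine ⟨(q.2 + 2 * 4 ^ m, q.1 + 2 * 4 ^ m), ?_, ?_⟩
    · rw [place, ← hq]
      simp
    · have : (0 : ℤ) < 4 ^ m := by positivity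
      rw [pow_succ]
      push_cast
      omega

theorem order_bijective : Function.Bijective order := by
  constructor
  · intro k l h
    obtain ⟨m, i, j, hi, hj, rfl, rfl⟩ := exists_section k l
    rw [order_add m (by omega), order_add m (by omega)] at h
    have e : (4 : ℕ) ^ (2 * m) = 16 ^ m := by rw [pow_mul]; norm_num
    rw [hilbert_injOn (2 * m) (by omega) (by omega) (place_injective m h)]
  · intro z
    obtain ⟨q, hq, ⟨h1, h2⟩, h3, h4⟩ := exists_place_eq z (z.1.natAbs + z.2.natAbs)
    generalize hm : z.1.natAbs + z.2.natAbs = m at *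
    have hm' : (m : ℤ) = |z.1| + |z.2| := by
      rw [← hm]; push_cast; rfl
    have e' : (2 : ℤ) ^ (2 * m) = 4 ^ m := by rw [pow_mul]; norm_num
    have e : (4 : ℕ) ^ (2 * m) = 16 ^ m := by rw [pow_mul]; norm_num
    obtain ⟨i, hi, hiq⟩ := hilbert_surjOn (2 * m) (x := q.1) (y := q.2) (by omega) (by omega)
      (by omega) (by omega)
    exact ⟨sectionStart m + i, by rw [order_add m (by omega), hiq, ← hq]⟩

theorem order_step (k : ℤ) : IsDir (order (k + 1) - order k) := by
  obtain ⟨m, i, -, hi, -, rfl, -⟩ := exists_section k k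
  have e : (4 : ℕ) ^ (2 * m) = 16 ^ m := by rw [pow_mul]; norm_num
  have h := hilbert_step (2 * m) i (by omega)
  have := order_add m hi
  push_cast at this
  rw [add_assoc, this, order_add m (by omega)]
  rcases place_sub m with h' | h' <;> rw [h']
  · exact h
  · rcases h with h | h | h | h <;> rw [h] <;> simp [IsDir]

/-- Adjacent parallel steps of the infinite Hilbert order never have the same direction. -/
theorem order_no_parallel (k l : ℤ) (d : ℤ × ℤ) (hd : IsDir d) (h1 : order l = order k + d)
    (h2 : order (l + 1) = order (k + 1) + d)
    (hperp : d.1 * (order (k + 1) - order k).1 + d.2 * (order (k + 1) - order k).2 = 0) :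
    False := by
  obtain ⟨m, i, j, hi, hj, rfl, rfl⟩ := exists_section k l
  have e : (4 : ℕ) ^ (2 * m) = 16 ^ m := by rw [pow_mul]; norm_num
  have e1 := order_add m hi
  have e2 := order_add m hj
  push_cast at e1 e2
  rw [add_assoc, add_assoc, e1, e2] at h2
  rw [add_assoc, e1, order_add m (by omega)] at hperp
  rw [order_add m (by omega), order_add m (by omega)] at h1
  rw [← sub_eq_iff_eq_add'] at h1 h2
  rcases place_sub m with h' | h' <;> rw [h'] at h1 h2 hperp
  · exact hilbert_no_parallel (2 * m) (by omega) (by omega) hd (eq_add_of_sub_eq' h1)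
      (eq_add_of_sub_eq' h2) hperp
  · refine hilbert_no_parallel (2 * m) (i := i) (j := j) (d := d.swap) (by omega)
      (by omega) ?_ ?_ ?_ ?_
    · rcases hd with rfl | rfl | rfl | rfl <;> simp [IsDir]
    · rw [← h1, Prod.swap_swap]; abel
    · rw [← h2, Prod.swap_swap]; abel
    · rw [← hperp]
      simp only [Prod.fst_swap, Prod.snd_swap]
      ring

theorem isInfiniteHilbertOrder_order : IsInfiniteHilbertOrder order := by
  have e : ∀ m : ℕ, (4 : ℤ) ^ (2 * m) = 16 ^ m := fun m => by rw [pow_mul]; norm_num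
  refine ⟨order_bijective, fun n => sectionStart (n / 2), fun n => ?_, fun k => ?_, fun n => ?_⟩
  · dsimp only
    rcases Nat.even_or_odd' n with ⟨m, rfl | rfl⟩
    · rw [show 2 * m / 2 = m by omega, show (2 * m + 1) / 2 = m by omega, pow_succ]
      have : (0 : ℤ) < 4 ^ (2 * m) := by positivity
      omega
    · rw [show (2 * m + 1) / 2 = m by omega, show (2 * m + 1 + 1) / 2 = m + 1 by omega,
        sectionStart, pow_succ, pow_succ, e]
      have := e m
      have : (0 : ℤ) < 16 ^ m := by positivity
      omega
  · refine ⟨2 * k.natAbs, ?_⟩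
    have := sectionStart_bounds k.natAbs
    dsimp only
    rw [e, show 2 * k.natAbs / 2 = k.natAbs by omega]
    omega
  · rcases Nat.even_or_odd' n with ⟨m, rfl | rfl⟩
    · refine ⟨place m, isLatticeIsometry_place m, fun i hi => ?_⟩
      rw [pow_mul] at hi
      dsimp only
      rw [show 2 * m / 2 = m by omega, order_add m (by simpa using hi)]
    · refine ⟨fun p => place (m + 1) (p.1 + 2 * 4 ^ m, p.2 + 2 * 4 ^ m), fun p q => ?_,
        fun i hi => ?_⟩
      · rw [isLatticeIsometry_place]
        ring
      · dsimp only
        rw [show (2 * m + 1) / 2 = m by omega, ← hilbert_second_half m i hi, ← order_add (m + 1)]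
        · rw [sectionStart]
          push_cast
          congr 1
          ring
        · have e' : (4 : ℕ) ^ (2 * m) = 16 ^ m := by rw [pow_mul]; norm_num
          rw [pow_succ, e'] at hi
          rw [pow_succ]
          omega

/-! ### The arms of the decoration -/

/-- The point at which the branch leaves the long segment of the decoration. -/
def junction : Plane := !₂[(1 : ℝ), 1]

/-- The three connections, numbered. -/
def conn : Fin 3 → Plane := ![!₂[(0 : ℝ), 1], !₂[(3 : ℝ), 1], !₂[(1 : ℝ), 0]]

/-- The arms of the decoration, from the junction to the connections. -/
def arm (x : Fin 3) : Set Plane := segment ℝ junction (conn x)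

theorem connections_eq_range : connections = range conn := by
  ext p
  simp [connections, conn]
  tauto

theorem mem_arm_iff (p : Plane) :
    (p ∈ arm 0 ↔ p 1 = 1 ∧ 0 ≤ p 0 ∧ p 0 ≤ 1) ∧ (p ∈ arm 1 ↔ p 1 = 1 ∧ 1 ≤ p 0 ∧ p 0 ≤ 3) ∧
      (p ∈ arm 2 ↔ p 0 = 1 ∧ 0 ≤ p 1 ∧ p 1 ≤ 1) := by
  unfold arm junction conn
  refine ⟨⟨?_, ?_⟩, ⟨?_, ?_⟩, ⟨?_, ?_⟩⟩
  · rintro ⟨a, b, ha, hb, hab, rfl⟩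
    simp
    exact ⟨by linarith, by linarith, by linarith⟩
  · rintro ⟨h1, h0, h3⟩
    exact ⟨p 0, 1 - p 0, by linarith, by linarith, by ring,
      plane_ext (by simp) (by simp [h1])⟩
  · rintro ⟨a, b, ha, hb, hab, rfl⟩
    simp
    exact ⟨by linarith, by linarith, by linarith⟩
  · rintro ⟨h1, h0, h3⟩
    exact ⟨(3 - p 0) / 2, (p 0 - 1) / 2, by linarith, by linarith, by ring,
      plane_ext (by simp; ring) (by simp [h1]; ring)⟩
  · rintro ⟨a, b, ha, hb, hab, rfl⟩
    simp
    exact ⟨by linarith, by linarith, by linarith⟩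
  · rintro ⟨h1, h0, h3⟩
    exact ⟨p 1, 1 - p 1, by linarith, by linarith, by ring,
      plane_ext (by simp [h1]) (by simp)⟩

theorem mem_decoration_iff_arm {p : Plane} : p ∈ decoration ↔ ∃ x, p ∈ arm x := by
  obtain ⟨h0, h1, h2⟩ := mem_arm_iff p
  rw [Fin.exists_fin_succ, Fin.exists_fin_succ, Fin.exists_fin_succ, mem_decoration]
  simp only [Fin.succ_zero_eq_one, Fin.succ_one_eq_two, h0, h1, h2, IsEmpty.exists_iff, or_false]
  rcases le_total (p 0) 1 with h | h <;> grind

theorem eq_junction_of_mem_arm {x y : Fin 3} (hxy : x ≠ y) {p : Plane} (hx : p ∈ arm x)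
    (hy : p ∈ arm y) : p = junction := by
  obtain ⟨h0, h1, h2⟩ := mem_arm_iff p
  have hp : p 0 = 1 ∧ p 1 = 1 := by
    fin_cases x <;> fin_cases y <;> simp only [Fin.zero_eta, Fin.mk_one, Fin.reduceFinMk, h0, h1,
      h2] at hx hy hxy <;> first
      | exact absurd rfl hxy
      | (constructor <;> linarith [hx.1, hx.2.1, hx.2.2, hy.1, hy.2.1, hy.2.2])
  exact plane_ext (by simp [hp.1, junction]) (by simp [hp.2, junction])

theorem conn_ne_junction (x : Fin 3) : conn x ≠ junction := by
  intro h
  have h0 := congrArg (fun p : Plane => p 0) h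
  have h1 := congrArg (fun p : Plane => p 1) h
  fin_cases x <;> simp [conn, junction] at h0 h1

theorem conn_mem_arm (x : Fin 3) : conn x ∈ arm x := right_mem_segment ℝ _ _

theorem junction_mem_arm (x : Fin 3) : junction ∈ arm x := left_mem_segment ℝ _ _

theorem eq_of_conn_mem_arm {x y : Fin 3} (h : conn x ∈ arm y) : x = y := by
  by_contra hne
  exact conn_ne_junction x (eq_junction_of_mem_arm hne (conn_mem_arm x) h)

theorem arm_subset_decoration (x : Fin 3) : arm x ⊆ decoration := fun _ h =>
  mem_decoration_iff_arm.2 ⟨x, h⟩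

/-! ### Tiles in the cells of the square grid -/

/-- Two lattice vectors are perpendicular. -/
def Perp (w w' : ℤ × ℤ) : Prop := w.1 * w'.1 + w.2 * w'.2 = 0

/-- The point on the edge in direction `w` of the cell `z` that is displaced from the middle of
the edge by half a unit in direction `w'`. -/
def edgePoint (z w w' : ℤ × ℤ) : Plane :=
  !₂[3 * (z.1 : ℝ) + 3 / 2 + 3 / 2 * w.1 + 1 / 2 * w'.1,
    3 * (z.2 : ℝ) + 3 / 2 + 3 / 2 * w.2 + 1 / 2 * w'.2]

/-- The same point seen from the cell across the edge; this makes the exit of a tile the entry of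
the next. -/
theorem edgePoint_neg (z w w' : ℤ × ℤ) : edgePoint (z + w) (-w) w' = edgePoint z w w' := by
  refine plane_ext ?_ ?_ <;> simp [edgePoint] <;> ring

/-- Edge points of different cells agree only if the cells are adjacent. -/
theorem eq_of_edgePoint_eq {z w w' y v v' : ℤ × ℤ} (hw : IsDir w) (hw' : IsDir w')
    (hp : Perp w w') (hv : IsDir v) (hv' : IsDir v') (hq : Perp v v') (hzy : z ≠ y)
    (h : edgePoint z w w' = edgePoint y v v') : y = z + w ∧ v = -w ∧ v' = w' := by
  -- Doubled coordinates are integers whose residues mod 6 reveal `w'`, and `w` up to sign.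
  have h0 : 6 * z.1 + 3 * w.1 + w'.1 = 6 * y.1 + 3 * v.1 + v'.1 := by
    have := congrArg (fun p : Plane => p 0) h
    simp only [edgePoint, PiLp.toLp_apply, Matrix.cons_val_zero] at this
    have h' : (6 * z.1 + 3 * w.1 + w'.1 : ℝ) = 6 * y.1 + 3 * v.1 + v'.1 := by linarith
    exact_mod_cast h'
  have h1 : 6 * z.2 + 3 * w.2 + w'.2 = 6 * y.2 + 3 * v.2 + v'.2 := by
    have := congrArg (fun p : Plane => p 1) h
    simp only [edgePoint, PiLp.toLp_apply, Matrix.cons_val_one, Matrix.cons_val_fin_one] at this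
    have h' : (6 * z.2 + 3 * w.2 + w'.2 : ℝ) = 6 * y.2 + 3 * v.2 + v'.2 := by linarith
    exact_mod_cast h'
  obtain ⟨z1, z2⟩ := z
  obtain ⟨y1, y2⟩ := y
  have hzy' : ¬(z1 = y1 ∧ z2 = y2) := fun h => hzy (by rw [h.1, h.2])
  clear h hzy
  unfold Perp at hp hq
  rcases hw with rfl | rfl | rfl | rfl <;> rcases hw' with rfl | rfl | rfl | rfl <;>
    simp at hp <;> rcases hv with rfl | rfl | rfl | rfl <;>
    rcases hv' with rfl | rfl | rfl | rfl <;> simp at hq <;>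
    dsimp only at h0 h1 <;> simp <;> omega

/-- The placed tile in the cell `z` whose axes point in the directions `u` and `v`. -/
theorem exists_placement (z : ℤ × ℤ) {u v : ℤ × ℤ} (hu : IsDir u) (hv : IsDir v)
    (huv : Perp u v) : ∃ g : Placement, g '' squareTile = gridSquare z ∧ ∀ p,
      g p = !₂[3 * (z.1 : ℝ) + 3 / 2 + (p 0 - 3 / 2) * u.1 + (p 1 - 3 / 2) * v.1,
        3 * (z.2 : ℝ) + 3 / 2 + (p 0 - 3 / 2) * u.2 + (p 1 - 3 / 2) * v.2] := by
  -- The matrix with columns `u`, `v` is orthogonal: its columns give the isometry, its rows the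
  -- inverse map.
  have hcases : (u.1 ^ 2 + u.2 ^ 2 = 1 ∧ v.1 ^ 2 + v.2 ^ 2 = 1 ∧ u.1 ^ 2 + v.1 ^ 2 = 1 ∧
      u.2 ^ 2 + v.2 ^ 2 = 1 ∧ u.1 * u.2 + v.1 * v.2 = 0) := by
    unfold Perp at huv
    rcases hu with rfl | rfl | rfl | rfl <;> rcases hv with rfl | rfl | rfl | rfl <;>
      simp at huv ⊢
  obtain ⟨a1, a2, a3, a4, a5⟩ := hcases
  have huv' : (u.1 * v.1 + u.2 * v.2 : ℝ) = 0 := by exact_mod_cast huv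
  have b1 : (u.1 ^ 2 + u.2 ^ 2 : ℝ) = 1 := by exact_mod_cast a1
  have b2 : (v.1 ^ 2 + v.2 ^ 2 : ℝ) = 1 := by exact_mod_cast a2
  have b3 : (u.1 ^ 2 + v.1 ^ 2 : ℝ) = 1 := by exact_mod_cast a3
  have b4 : (u.2 ^ 2 + v.2 ^ 2 : ℝ) = 1 := by exact_mod_cast a4
  have b5 : (u.1 * u.2 + v.1 * v.2 : ℝ) = 0 := by exact_mod_cast a5
  let f : Plane → Plane := fun p =>
    !₂[3 * (z.1 : ℝ) + 3 / 2 + (p 0 - 3 / 2) * u.1 + (p 1 - 3 / 2) * v.1,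
        3 * (z.2 : ℝ) + 3 / 2 + (p 0 - 3 / 2) * u.2 + (p 1 - 3 / 2) * v.2]
  let f' : Plane → Plane := fun q =>
    !₂[(q 0 - (3 * (z.1 : ℝ) + 3 / 2)) * u.1 + (q 1 - (3 * (z.2 : ℝ) + 3 / 2)) * u.2 + 3 / 2,
      (q 0 - (3 * (z.1 : ℝ) + 3 / 2)) * v.1 + (q 1 - (3 * (z.2 : ℝ) + 3 / 2)) * v.2 + 3 / 2]
  have hff' : ∀ q, f (f' q) = q := by
    intro q
    refine plane_ext ?_ ?_
    · simp only [f, f', Matrix.cons_val_zero, Matrix.cons_val_one,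
        Matrix.cons_val_fin_one]
      linear_combination (q 0 - (3 * (z.1 : ℝ) + 3 / 2)) * b3 +
        (q 1 - (3 * (z.2 : ℝ) + 3 / 2)) * b5
    · simp only [f, f', Matrix.cons_val_zero, Matrix.cons_val_one,
        Matrix.cons_val_fin_one]
      linear_combination (q 1 - (3 * (z.2 : ℝ) + 3 / 2)) * b4 +
        (q 0 - (3 * (z.1 : ℝ) + 3 / 2)) * b5
  have hf : Isometry f := by
    refine Isometry.of_dist_eq fun p q => ?_
    simp only [EuclideanSpace.dist_eq, Fin.sum_univ_two, Real.dist_eq, sq_abs]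
    congr 1
    simp only [f, Matrix.cons_val_zero, Matrix.cons_val_one,
        Matrix.cons_val_fin_one]
    linear_combination (p 0 - q 0) ^ 2 * b1 + (p 1 - q 1) ^ 2 * b2 +
      2 * (p 0 - q 0) * (p 1 - q 1) * huv'
  refine ⟨IsometryEquiv.mk' f f' hff' hf, ?_, fun p => rfl⟩
  have hmem : ∀ p, f p ∈ gridSquare z ↔ p ∈ squareTile := by
    intro p
    simp only [gridSquare, squareTile, mem_ofPred_eq, f, Matrix.cons_val_zero,
      Matrix.cons_val_one, Matrix.cons_val_fin_one]
    clear hff' hf f f' a1 a2 a3 a4 a5 huv' b1 b2 b3 b4 b5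
    unfold Perp at huv
    rcases hu with rfl | rfl | rfl | rfl <;> rcases hv with rfl | rfl | rfl | rfl <;>
      simp at huv <;> push_cast <;> constructor <;> rintro ⟨h1, h2, h3, h4⟩ <;>
      refine ⟨?_, ?_, ?_, ?_⟩ <;> linarith
  ext q
  constructor
  · rintro ⟨p, hp, rfl⟩
    exact (hmem p).2 hp
  · intro hq
    exact ⟨f' q, (hmem _).1 (by rwa [hff']), hff' q⟩

/-- The tile in a cell that a path enters in direction `i` and leaves in direction `o`, with the
connections displaced from the middle of the edges in the directions `n` and `n'`. -/
theorem exists_tile (z : ℤ × ℤ) {i o n n' : ℤ × ℤ} (hi : IsDir i) (ho : IsDir o) (hn : IsDir n)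
    (hin : Perp i n) (hne : o ≠ -i) (hturn : o ≠ i → n' = -i) (hstraight : o = i → n' = n) :
    ∃ (g : Placement) (f : ℤ × ℤ) (a b d : Fin 3), g '' squareTile = gridSquare z ∧
      IsDir f ∧ Perp f i ∧ f ≠ o ∧ a ≠ b ∧ a ≠ d ∧ b ≠ d ∧
      g (conn a) = edgePoint z (-i) n ∧ g (conn b) = edgePoint z o n' ∧
      g (conn d) = edgePoint z f (-i) := by
  have hneg : ∀ w : ℤ × ℤ, IsDir w → IsDir (-w) := by
    rintro w (rfl | rfl | rfl | rfl) <;> simp [IsDir]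
  -- A straight passage follows the long segment, reflected so that the branch lies on the side `n`.
  -- A turn enters by the branch and leaves along the half of the long segment that points towards
  -- `o`. In both cases the dead end is displaced towards `-i`.
  rcases eq_or_ne o i with rfl | hoi
  · obtain rfl := hstraight rfl
    obtain ⟨g, hg, hgp⟩ := exists_placement z ho (hneg _ hn)
      (by unfold Perp at *; simp only [Prod.fst_neg, Prod.snd_neg]; linarith)
    refine ⟨g, n', 0, 1, 2, hg, hn, by unfold Perp at *; linarith, ?_, by decide, by decide,
      by decide, ?_, ?_, ?_⟩
    · rintro rfl
      unfold Perp at hin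
      rcases hn with rfl | rfl | rfl | rfl <;> simp at hin
    all_goals
      rw [hgp]
      refine plane_ext ?_ ?_ <;> simp [conn, edgePoint] <;> ring
  · obtain rfl := hturn hoi
    obtain ⟨g, hg, hgp⟩ := exists_placement z (hneg _ hn) hi
      (by unfold Perp at *; simp only [Prod.fst_neg, Prod.snd_neg]; linarith)
    have hno : o = n ∨ o = -n := by
      unfold Perp at hin
      rcases hi with rfl | rfl | rfl | rfl <;> rcases hn with rfl | rfl | rfl | rfl <;>
        simp at hin <;> rcases ho with rfl | rfl | rfl | rfl <;> simp at hne hoi ⊢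
    have hon : o ≠ 0 := by
      rintro rfl
      simp [IsDir, Prod.ext_iff] at ho
    rcases hno with rfl | rfl
    · refine ⟨g, -o, 2, 0, 1, hg, hneg _ hn,
        by unfold Perp at *; simp only [Prod.fst_neg, Prod.snd_neg]; linarith, ?_, by decide,
        by decide, by decide, ?_, ?_, ?_⟩
      · exact fun h => hon (self_eq_neg.1 h.symm)
      all_goals
        rw [hgp]
        refine plane_ext ?_ ?_ <;> simp [conn, edgePoint] <;> ring
    · refine ⟨g, n, 2, 1, 0, hg, hn,
        by unfold Perp at *; linarith, ?_, by decide,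
        by decide, by decide, ?_, ?_, ?_⟩
      · intro h
        exact hon (by rw [← h, self_eq_neg.1 h])
      all_goals
        rw [hgp]
        refine plane_ext ?_ ?_ <;> simp [conn, edgePoint] <;> ring

/-! ### The sides of the connections -/

/-- `s k` is the latest nonzero value of `t` up to `k`; the default 1 covers the case that there has
been none. -/
theorem exists_last_nonzero (t : ℤ → ℤ) : ∃ s : ℤ → ℤ, (∀ k, t k ≠ 0 → s k = t k) ∧
    (∀ k, t k = 0 → s k = s (k - 1)) ∧ ∀ k, s k = 1 ∨ ∃ j, t j ≠ 0 ∧ s k = t j := by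
  classical
  let L : ℤ → ℤ → Prop := fun k j => j ≤ k ∧ t j ≠ 0 ∧ ∀ l, j < l → l ≤ k → t l = 0
  let s : ℤ → ℤ := fun k => if h : ∃ j, L k j then t h.choose else 1
  refine ⟨s, fun k hk => ?_, fun k hk => ?_, fun k => ?_⟩
  · have h : ∃ j, L k j := ⟨k, le_rfl, hk, fun l h1 h2 => absurd h2 (not_le.2 h1)⟩
    have hs : s k = t h.choose := dif_pos h
    rw [hs]
    obtain ⟨h1, h2, h3⟩ := h.choose_spec
    rcases h1.lt_or_eq with h1 | h1
    · exact absurd (h3 k h1 le_rfl) hk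
    · rw [h1]
  · have : L k = L (k - 1) := by
      funext j
      refine propext ⟨fun ⟨h1, h2, h3⟩ => ⟨?_, h2, fun l h4 h5 => h3 l h4 (by omega)⟩,
        fun ⟨h1, h2, h3⟩ => ⟨by omega, h2, fun l h4 h5 => ?_⟩⟩
      · have : j ≠ k := fun h => h2 (h ▸ hk)
        omega
      · rcases h5.lt_or_eq with h5 | rfl
        · exact h3 l h4 (by omega)
        · exact hk
    simp only [s, this]
  · by_cases h : ∃ j, L k j
    · exact Or.inr ⟨_, h.choose_spec.2.1, dif_pos h⟩
    · exact Or.inl (dif_neg h)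

/-- The displacement points to the inner side of the most recent turn. The cross product of
successive directions is the sign of the turn, and that sign times the left normal of `o k` is the
required vector. -/
theorem exists_sides (o : ℤ → ℤ × ℤ) (ho : ∀ k, IsDir (o k)) (hne : ∀ k, o k ≠ -o (k - 1)) :
    ∃ n : ℤ → ℤ × ℤ, ∀ k, IsDir (n k) ∧ Perp (o k) (n k) ∧ (o k ≠ o (k - 1) → n k = -o (k - 1)) ∧
      (o k = o (k - 1) → n k = n (k - 1)) := by
  obtain ⟨s, hs1, hs2, hs3⟩ := exists_last_nonzero
    (fun k => (o (k - 1)).1 * (o k).2 - (o (k - 1)).2 * (o k).1)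
  have hs : ∀ k, s k = 1 ∨ s k = -1 := by
    intro k
    rcases hs3 k with h | ⟨j, hj, h⟩
    · exact Or.inl h
    · rw [h]
      rcases ho (j - 1) with h1 | h1 | h1 | h1 <;> rcases ho j with h2 | h2 | h2 | h2 <;>
        simp [h1, h2] at hj ⊢
  refine ⟨fun k => (-(s k * (o k).2), s k * (o k).1), fun k => ⟨?_, ?_, fun h => ?_, fun h => ?_⟩⟩
  · rcases hs k with h | h <;> rcases ho k with h2 | h2 | h2 | h2 <;> simp [h, h2, IsDir]
  · simp only [Perp]; ring
  · have h1 := hs1 k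
    have h2 := hne k
    rcases ho (k - 1) with h3 | h3 | h3 | h3 <;> rcases ho k with h4 | h4 | h4 | h4 <;>
      simp [h3, h4] at h h1 h2 ⊢ <;> omega
  · have h1 := hs2 k (by simp only [h]; ring)
    simp only [h, h1]

/-! ### Tilings along a path of cells -/

/-- A tiling whose tiles are the cells of the square grid, enumerated along a path, such that
consecutive tiles are connected and the third connection of every tile is a dead end. -/
structure PathTiling where
  cell : ℤ → ℤ × ℤ
  tile : ℤ → Placement
  entry : ℤ → Fin 3
  exit : ℤ → Fin 3
  dead : ℤ → Fin 3
  cell_bijective : Function.Bijective cell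
  image_tile : ∀ k, tile k '' squareTile = gridSquare (cell k)
  entry_ne_exit : ∀ k, entry k ≠ exit k
  entry_ne_dead : ∀ k, entry k ≠ dead k
  exit_ne_dead : ∀ k, exit k ≠ dead k
  exit_eq_entry : ∀ k, tile k (conn (exit k)) = tile (k + 1) (conn (entry (k + 1)))
  eq_exit_of_mem : ∀ k l p, k ≠ l → p ∈ tile k '' connections → p ∈ tile l '' connections →
    (l = k + 1 ∧ p = tile k (conn (exit k))) ∨ (k = l + 1 ∧ p = tile l (conn (exit l)))

theorem eq_of_ne_of_ne {a b d x : Fin 3} (hab : a ≠ b) (had : a ≠ d) (hbd : b ≠ d) :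
    x = a ∨ x = b ∨ x = d := by
  revert a b d x
  decide

/-- Tiles along a path of cells without adjacent parallel steps in the same direction can be chosen
so that they are connected exactly along the path. -/
theorem exists_pathTiling (c : ℤ → ℤ × ℤ) (hc : Function.Bijective c)
    (hstep : ∀ k, IsDir (c (k + 1) - c k))
    (hpar : ∀ k l d, IsDir d → c l = c k + d → c (l + 1) = c (k + 1) + d →
      d.1 * (c (k + 1) - c k).1 + d.2 * (c (k + 1) - c k).2 = 0 → False) :
    ∃ X : PathTiling, X.cell = c := by
  have hneg : ∀ w : ℤ × ℤ, IsDir w → IsDir (-w) := by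
    rintro w (rfl | rfl | rfl | rfl) <;> simp [IsDir]
  have hdir0 : ¬IsDir 0 := by simp [IsDir, Prod.ext_iff]
  obtain ⟨o, ho⟩ : ∃ o : ℤ → ℤ × ℤ, ∀ k, o k = c (k + 1) - c k := ⟨_, fun _ => rfl⟩
  have hcs : ∀ k, c (k + 1) = c k + o k := fun k => by rw [ho]; abel
  have hdir : ∀ k, IsDir (o k) := fun k => by rw [ho]; exact hstep k
  have hback : ∀ k, o k ≠ -o (k - 1) := by
    intro k h
    rw [ho, ho, sub_add_cancel, neg_sub, sub_left_inj] at h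
    have := hc.1 h
    omega
  obtain ⟨n, hn⟩ := exists_sides o hdir hback
  have hperp : ∀ k, Perp (o k) (n k) := fun k => (hn k).2.1
  have hperp' : ∀ k, Perp (o (k - 1)) (n (k - 1)) := fun k => hperp (k - 1)
  choose g f a b d hg hf hfp hfo hab had hbd ha hb hd using fun k =>
    exists_tile (c k) (hdir (k - 1)) (hdir k) (hn (k - 1)).1 (hperp (k - 1)) (hback k)
      (hn k).2.2.1 (hn k).2.2.2
  have hexit : ∀ k, g k (conn (b k)) = g (k + 1) (conn (a (k + 1))) := by
    intro k
    rw [hb, ha, add_sub_cancel_right, hcs, edgePoint_neg]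
  refine ⟨⟨c, g, a, b, d, hc, hg, hab, had, hbd, hexit, ?_⟩, rfl⟩
  rintro k l _ hkl ⟨p, hp, rfl⟩ ⟨q, hq, hqp⟩
  rw [connections_eq_range] at hp hq
  obtain ⟨x, rfl⟩ := hp
  obtain ⟨y, rfl⟩ := hq
  have hneg_perp : ∀ w w' : ℤ × ℤ, Perp w w' → Perp (-w) w' := fun w w' h => by
    unfold Perp at *; simp only [Prod.fst_neg, Prod.snd_neg]; linarith
  have hperp_neg : ∀ w w' : ℤ × ℤ, Perp w w' → Perp w (-w') := fun w w' h => by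
    unfold Perp at *; simp only [Prod.fst_neg, Prod.snd_neg]; linarith
  have hself : ∀ w, IsDir w → ¬Perp w w := by
    rintro w (rfl | rfl | rfl | rfl) <;> simp [Perp]
  have hcne : c k ≠ c l := fun h => hkl (hc.1 h)
  have hsucc : ∀ {i j : ℤ}, c j = c i + o i → j = i + 1 := fun {i j} h =>
    hc.1 (by rw [h, hcs])
  have hpred : ∀ {i j : ℤ}, c j = c i + -o (i - 1) → i = j + 1 := fun {i j} h => by
    have h1 := hcs (i - 1)
    rw [sub_add_cancel] at h1
    have : j = i - 1 := hc.1 (by rw [h, h1]; abel)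
    omega
  -- the dead end of a tile is not connected to the entry or the exit of another one
  have hdead : ∀ i j v v', c i ≠ c j → IsDir v → IsDir v' → Perp v v' →
      (v = -o (j - 1) ∨ v = o j) → edgePoint (c i) (f i) (-o (i - 1)) ≠ edgePoint (c j) v v' := by
    intro i j v v' hij hv hv' hvp h heq
    obtain ⟨h1, h2, -⟩ := eq_of_edgePoint_eq (hf i) (hneg _ (hdir _)) (hperp_neg _ _ (hfp i))
      hv hv' hvp hij heq
    -- The path would cross the edge of the dead end, making it the exit edge or the entry edge of
    -- cell `c i`; but `f i` differs from `o i` and is perpendicular to `o (i - 1)`.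
    rcases h with rfl | rfl
    · have h3 : j = i + 1 := by
        apply hsucc
        have h4 := hpred (i := j) (j := i) (by rw [h1, h2]; abel)
        rw [h4, hcs]
      subst h3
      rw [add_sub_cancel_right] at h2
      exact hfo i (neg_injective h2).symm
    · have h3 : i = j + 1 := hsucc (by rw [h1, h2]; abel)
      have h4 := hfp i
      rw [h3, add_sub_cancel_right, h2, ← h3] at h4
      exact hself _ (hf i) (by simpa using hperp_neg _ _ h4)
  rcases eq_of_ne_of_ne (x := x) (hab k) (had k) (hbd k) with rfl | rfl | rfl
  · rcases eq_of_ne_of_ne (x := y) (hab l) (had l) (hbd l) with rfl | rfl | rfl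
    all_goals rw [ha k]
    · rw [ha k, ha l] at hqp
      obtain ⟨h1, -, -⟩ := eq_of_edgePoint_eq (hneg _ (hdir _)) (hn _).1
        (hneg_perp _ _ (hperp' _)) (hneg _ (hdir _)) (hn _).1 (hneg_perp _ _ (hperp' _)) hcne
        hqp.symm
      have h2 := hpred h1
      exact Or.inr ⟨h2, by rw [hexit, ← h2, ha]⟩
    · rw [ha k, hb l] at hqp
      obtain ⟨h1, -, -⟩ := eq_of_edgePoint_eq (hneg _ (hdir _)) (hn _).1
        (hneg_perp _ _ (hperp' _)) (hdir _) (hn _).1 (hperp _) hcne hqp.symm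
      have h2 := hpred h1
      exact Or.inr ⟨h2, by rw [hexit, ← h2, ha]⟩
    · rw [ha k, hd l] at hqp
      exact absurd hqp (hdead l k _ _ hcne.symm (hneg _ (hdir _)) (hn _).1
        (hneg_perp _ _ (hperp' _)) (Or.inl rfl))
  · rcases eq_of_ne_of_ne (x := y) (hab l) (had l) (hbd l) with rfl | rfl | rfl
    · rw [hb k, ha l] at hqp
      obtain ⟨h1, -, -⟩ := eq_of_edgePoint_eq (hdir _) (hn _).1
        (hperp _) (hneg _ (hdir _)) (hn _).1 (hneg_perp _ _ (hperp' _)) hcne hqp.symm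
      exact Or.inl ⟨hsucc h1, rfl⟩
    · rw [hb k, hb l] at hqp
      obtain ⟨h1, -, -⟩ := eq_of_edgePoint_eq (hdir _) (hn _).1
        (hperp _) (hdir _) (hn _).1 (hperp _) hcne hqp.symm
      exact Or.inl ⟨hsucc h1, rfl⟩
    · rw [hb k, hd l] at hqp
      exact absurd hqp (hdead l k _ _ hcne.symm (hdir _) (hn _).1 (hperp _) (Or.inr rfl))
  · rcases eq_of_ne_of_ne (x := y) (hab l) (had l) (hbd l) with rfl | rfl | rfl
    · rw [hd k, ha l] at hqp
      exact absurd hqp.symm (hdead k l _ _ hcne (hneg _ (hdir _)) (hn _).1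
        (hneg_perp _ _ (hperp' _)) (Or.inl rfl))
    · rw [hd k, hb l] at hqp
      exact absurd hqp.symm (hdead k l _ _ hcne (hdir _) (hn _).1 (hperp _) (Or.inr rfl))
    -- Two dead ends meet: equal displacements mean equal incoming directions, so the steps into the
    -- two cells are adjacent, parallel and codirectional, against `hpar`.
    · rw [hd k, hd l] at hqp
      obtain ⟨h1, h2, h3⟩ := eq_of_edgePoint_eq (hf k) (hneg _ (hdir _))
        (hperp_neg _ _ (hfp k)) (hf l) (hneg _ (hdir _)) (hperp_neg _ _ (hfp l)) hcne hqp.symm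
      have h4 : o (l - 1) = o (k - 1) := neg_injective h3
      have e1 := hcs (k - 1)
      have e2 := hcs (l - 1)
      rw [sub_add_cancel] at e1 e2
      refine (hpar (k - 1) (l - 1) (f k) (hf k) ?_ ?_ ?_).elim
      · rw [h4] at e2
        rw [e1, e2] at h1
        rw [← sub_eq_zero] at h1 ⊢
        rw [← h1]; abel
      · rw [sub_add_cancel, sub_add_cancel, h1]
      · rw [← ho]
        exact hfp k

/-! ### Tiling, rule R2 and connectedness for path tilings. -/

namespace PathTiling

variable (X : PathTiling)

/-- The family of tiles. -/
def tiles : Set Placement := range X.tile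

theorem tile_injective : Function.Injective X.tile := by
  intro k l h
  have hg : gridSquare (X.cell k) = gridSquare (X.cell l) := by
    rw [← X.image_tile, ← X.image_tile, h]
  apply X.cell_bijective.1
  have h1 : (!₂[3 * ((X.cell k).1 : ℝ), 3 * ((X.cell k).2 : ℝ)] : Plane) ∈
      gridSquare (X.cell l) := by
    rw [← hg]; simp [gridSquare]
  have h2 : (!₂[3 * ((X.cell l).1 : ℝ), 3 * ((X.cell l).2 : ℝ)] : Plane) ∈
      gridSquare (X.cell k) := by
    rw [hg]; simp [gridSquare]
  simp [gridSquare] at h1 h2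
  exact Prod.ext (le_antisymm h2.1 h1.1) (le_antisymm h2.2.2.1 h1.2.2.1)

theorem image_interior (k : ℤ) :
    X.tile k '' interior squareTile = interior (gridSquare (X.cell k)) := by
  rw [← X.image_tile]
  exact (X.tile k).toHomeomorph.image_interior _

theorem disjoint_interior {k l : ℤ} (h : k ≠ l) :
    Disjoint (X.tile k '' interior squareTile) (X.tile l '' interior squareTile) := by
  rw [image_interior, image_interior, disjoint_left]
  unfold gridSquare
  rw [interior_box, interior_box]
  rintro p ⟨h1, h2, h3, h4⟩ ⟨k1, k2, k3, k4⟩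
  apply h
  apply X.cell_bijective.1
  have a1 : (3 * (X.cell k).1 : ℝ) < 3 * (X.cell l).1 + 3 := by linarith
  have a2 : (3 * (X.cell l).1 : ℝ) < 3 * (X.cell k).1 + 3 := by linarith
  have a3 : (3 * (X.cell k).2 : ℝ) < 3 * (X.cell l).2 + 3 := by linarith
  have a4 : (3 * (X.cell l).2 : ℝ) < 3 * (X.cell k).2 + 3 := by linarith
  norm_cast at a1 a2 a3 a4
  exact Prod.ext (by omega) (by omega)

theorem exists_mem_gridSquare (p : Plane) : ∃ k, p ∈ gridSquare (X.cell k) := by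
  obtain ⟨k, hk⟩ := X.cell_bijective.2 (⌊p 0 / 3⌋, ⌊p 1 / 3⌋)
  refine ⟨k, ?_⟩
  rw [hk]
  have h0 := Int.floor_le (p 0 / 3)
  have h1 := Int.lt_floor_add_one (p 0 / 3)
  have h2 := Int.floor_le (p 1 / 3)
  have h3 := Int.lt_floor_add_one (p 1 / 3)
  refine ⟨?_, ?_, ?_, ?_⟩ <;> dsimp only <;> linarith

theorem isTiling : IsTiling X.tiles := by
  constructor
  · refine eq_univ_of_forall fun p => ?_
    obtain ⟨k, hk⟩ := X.exists_mem_gridSquare p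
    rw [← X.image_tile] at hk
    exact mem_biUnion (mem_range_self k) hk
  · rintro _ ⟨k, rfl⟩ _ ⟨l, rfl⟩ h
    exact X.disjoint_interior fun hkl => h (by rw [hkl])

/-- The decorations of different tiles meet only at the connections of consecutive tiles. -/
theorem eq_exit_of_mem_decoration {k l : ℤ} {p : Plane} (h : k ≠ l)
    (hk : p ∈ X.tile k '' decoration) (hl : p ∈ X.tile l '' decoration) :
    (l = k + 1 ∧ p = X.tile k (conn (X.exit k))) ∨
      (k = l + 1 ∧ p = X.tile l (conn (X.exit l))) :=
  X.eq_exit_of_mem k l p h (mem_connections_of_mem_decoration (X.disjoint_interior h) hk hl)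
    (mem_connections_of_mem_decoration (X.disjoint_interior h.symm) hl hk)

theorem eq_entry_or_exit {k l : ℤ} {p : Plane} (h : k ≠ l)
    (hl : X.tile k p ∈ X.tile l '' decoration) (hp : p ∈ decoration) :
    p = conn (X.entry k) ∨ p = conn (X.exit k) := by
  rcases X.eq_exit_of_mem_decoration h (mem_image_of_mem _ hp) hl with ⟨-, h2⟩ | ⟨rfl, h2⟩
  · exact Or.inr ((X.tile k).injective h2)
  · rw [X.exit_eq_entry] at h2
    exact Or.inl ((X.tile _).injective h2)

theorem exit_mem_decoration_succ (k : ℤ) :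
    X.tile k (conn (X.exit k)) ∈ X.tile k '' decoration ∩ X.tile (k + 1) '' decoration := by
  constructor
  · exact mem_image_of_mem _ (arm_subset_decoration _ (conn_mem_arm _))
  · rw [X.exit_eq_entry]
    exact mem_image_of_mem _ (arm_subset_decoration _ (conn_mem_arm _))

/-- The tiles are placed in the order 0, -1, 1, -2, …, so each new one continues the path at one
end. The dead end of a tile meets no other decoration, so it is open at every stage. -/
theorem generatedByR2 : GeneratedByR2 X.tiles := by
  refine ⟨fun n => X.tile (Equiv.intEquivNat.symm n),
    X.tile_injective.comp Equiv.intEquivNat.symm.injective,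
    Equiv.intEquivNat.symm.surjective.range_comp X.tile, fun n hn => ?_, fun n m _ => ?_⟩
  · obtain ⟨k, rfl⟩ := Equiv.intEquivNat.surjective n
    cases k with
    | ofNat j =>
      cases j with
      | zero => exact absurd hn (by decide)
      | succ j =>
        refine ⟨Equiv.intEquivNat (Int.ofNat j), ?_, ?_⟩
        · change 2 * j < 2 * (j + 1)
          omega
        · simp only [Equiv.symm_apply_apply]
          rw [inter_comm]
          exact ⟨_, X.exit_mem_decoration_succ j⟩
    | negSucc j =>
      cases j with
      | zero =>
        refine ⟨Equiv.intEquivNat (Int.ofNat 0), by decide, ?_⟩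
        simp only [Equiv.symm_apply_apply]
        exact ⟨_, X.exit_mem_decoration_succ (-1)⟩
      | succ j =>
        refine ⟨Equiv.intEquivNat (Int.negSucc j), ?_, ?_⟩
        · change 2 * j + 1 < 2 * (j + 1) + 1
          omega
        · simp only [Equiv.symm_apply_apply]
          have := X.exit_mem_decoration_succ (Int.negSucc (j + 1))
          rw [show Int.negSucc (j + 1) + 1 = Int.negSucc j by omega] at this
          exact ⟨_, this⟩
  · obtain ⟨k, rfl⟩ := Equiv.intEquivNat.surjective m
    simp only [HasOpenConnection, Equiv.symm_apply_apply]
    refine ⟨X.tile k (conn (X.dead k)), mem_image_of_mem _ ?_, ?_⟩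
    · rw [connections_eq_range]
      exact mem_range_self _
    · rintro _ ⟨l, -, rfl⟩ hne hmem
      have hkl : k ≠ Equiv.intEquivNat.symm l := fun h => hne (by rw [h])
      rcases X.eq_entry_or_exit hkl hmem (arm_subset_decoration _ (conn_mem_arm _)) with h | h
      · exact X.entry_ne_dead k (eq_of_conn_mem_arm (h ▸ conn_mem_arm (X.dead k)))
      · exact X.exit_ne_dead k (eq_of_conn_mem_arm (h ▸ conn_mem_arm (X.dead k)))

theorem decorationUnion_eq : decorationUnion X.tiles = ⋃ k, X.tile k '' decoration := by
  simp [decorationUnion, tiles]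

theorem isConnected_decoration : IsConnected decoration := by
  have : decoration = ⋃ x, arm x := by
    ext p
    rw [mem_decoration_iff_arm, mem_iUnion]
  rw [this]
  refine ⟨⟨junction, mem_iUnion.2 ⟨0, junction_mem_arm 0⟩⟩,
    isPreconnected_iUnion ⟨junction, mem_iInter.2 junction_mem_arm⟩ fun x => ?_⟩
  exact (convex_segment _ _).isPreconnected

theorem isConnected_decorationUnion : IsConnected (decorationUnion X.tiles) := by
  rw [decorationUnion_eq]
  refine IsConnected.iUnion_of_chain (fun k => ?_) fun k => ?_
  · exact isConnected_decoration.image _ (X.tile k).continuous.continuousOn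
  · exact ⟨_, X.exit_mem_decoration_succ k⟩

theorem finite_meeting (p : Plane) (R : ℝ) :
    {k | (gridSquare (X.cell k) ∩ Metric.closedBall p R).Nonempty}.Finite := by
  have hf : (X.cell ⁻¹' Icc (⌊(p 0 - R) / 3⌋ - 1, ⌊(p 1 - R) / 3⌋ - 1)
      (⌈(p 0 + R) / 3⌉, ⌈(p 1 + R) / 3⌉)).Finite :=
    (finite_Icc _ _).preimage X.cell_bijective.1.injOn
  refine hf.subset ?_
  rintro k ⟨q, ⟨h1, h2, h3, h4⟩, hq⟩
  have hd : ∀ i, |q i - p i| ≤ R := fun i =>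
    le_trans (by simpa [dist_eq_norm] using PiLp.norm_apply_le (q - p) i)
      (Metric.mem_closedBall.1 hq)
  have d0 := abs_le.1 (hd 0)
  have d1 := abs_le.1 (hd 1)
  have f0 := Int.floor_le ((p 0 - R) / 3)
  have f1 := Int.floor_le ((p 1 - R) / 3)
  have c0 := Int.le_ceil ((p 0 + R) / 3)
  have c1 := Int.le_ceil ((p 1 + R) / 3)
  refine ⟨⟨?_, ?_⟩, ⟨?_, ?_⟩⟩ <;> dsimp only
  · have : ((⌊(p 0 - R) / 3⌋ - 1 : ℤ) : ℝ) ≤ (X.cell k).1 := by push_cast; linarith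
    exact_mod_cast this
  · have : ((⌊(p 1 - R) / 3⌋ - 1 : ℤ) : ℝ) ≤ (X.cell k).2 := by push_cast; linarith
    exact_mod_cast this
  · have : ((X.cell k).1 : ℝ) ≤ (⌈(p 0 + R) / 3⌉ : ℤ) := by linarith
    exact_mod_cast this
  · have : ((X.cell k).2 : ℝ) ≤ (⌈(p 1 + R) / 3⌉ : ℤ) := by linarith
    exact_mod_cast this

theorem locallyFinite_gridSquare : LocallyFinite fun k => gridSquare (X.cell k) := fun p =>
  ⟨Metric.closedBall p 1, Metric.closedBall_mem_nhds p one_pos, X.finite_meeting p 1⟩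

end PathTiling

/-! ### Polygonal chains -/

theorem polyline_eq (v : ℤ → Plane) (m : ℤ) {s : ℝ} (h0 : (m : ℝ) ≤ s) (h1 : s ≤ m + 1) :
    polyline v s = AffineMap.lineMap (v m) (v (m + 1)) (s - m) := by
  rcases h1.lt_or_eq with h | rfl
  · have hf : ⌊s⌋ = m := Int.floor_eq_iff.2 ⟨h0, h⟩
    rw [polyline, ← Int.self_sub_floor, hf]
  · have hf : ⌊(m : ℝ) + 1⌋ = m + 1 := by simp
    rw [polyline, ← Int.self_sub_floor, hf]
    simp

theorem continuous_polyline (v : ℤ → Plane) : Continuous (polyline v) := by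
  refine LocallyFinite.continuous (f := fun m : ℤ => Icc (m : ℝ) (m + 1)) (fun s => ?_) ?_
    (fun m => isClosed_Icc) fun m => ?_
  · refine ⟨Ioo (s - 1) (s + 1), Ioo_mem_nhds (by linarith) (by linarith), ?_⟩
    refine (finite_Icc ⌊s - 2⌋ ⌈s + 1⌉).subset ?_
    rintro m ⟨x, ⟨h1, h2⟩, h3, h4⟩
    have f := Int.floor_le (s - 2)
    have c := Int.le_ceil (s + 1)
    constructor
    · have : (⌊s - 2⌋ : ℝ) ≤ m := by linarith
      exact_mod_cast this
    · have : (m : ℝ) ≤ ⌈s + 1⌉ := by linarith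
      exact_mod_cast this
  · exact eq_univ_of_forall fun s =>
      mem_iUnion.2 ⟨⌊s⌋, Int.floor_le s, (Int.lt_floor_add_one s).le⟩
  · have hc : Continuous fun s : ℝ => (AffineMap.lineMap (v m) (v (m + 1)) (s - m) : Plane) :=
      AffineMap.lineMap_continuous.comp (by fun_prop)
    exact hc.continuousOn.congr fun s hs => polyline_eq v m hs.1 hs.2

/-- A self-avoiding curve contained in a self-avoiding curve that is unlimited in both directions
is all of it, if it is unlimited in both directions too. -/
theorem range_eq_of_range_subset {γ Γ : ℝ → Plane} (hγ : IsUnlimitedSelfAvoiding γ)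
    (hΓ : IsUnlimitedSelfAvoiding Γ) (h : range γ ⊆ range Γ) : range γ = range Γ := by
  obtain ⟨hγ1, hγ2, hγ3⟩ := hγ
  obtain ⟨hΓ1, hΓ2, hΓ3⟩ := hΓ
  -- Properness makes `Γ` an embedding, so `γ` lifts to a continuous injective map of the line,
  -- which is proper because `γ` is.
  have hproper : IsProperMap Γ := isProperMap_iff_tendsto_cocompact.2 ⟨hΓ1, hΓ3⟩
  have hemb : IsEmbedding Γ :=
    (IsClosedEmbedding.of_continuous_injective_isClosedMap hΓ1 hΓ2
      hproper.isClosedMap).isEmbedding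
  choose f hf using fun s => h (mem_range_self s)
  have hfe : Γ ∘ f = γ := funext hf
  have hfc : Continuous f := by
    rw [hemb.continuous_iff, hfe]
    exact hγ1
  have hfi : Function.Injective f := fun a b hab => hγ2 (by rw [← hf, ← hf, hab])
  have hft : Tendsto f (cocompact ℝ) (cocompact ℝ) := by
    rw [hasBasis_cocompact.tendsto_right_iff]
    intro K hK
    filter_upwards [hγ3 (hK.image hΓ1).compl_mem_cocompact] with s hs hsK
    exact hs ⟨f s, hsK, hf s⟩
  rw [cocompact_eq_atBot_atTop, tendsto_sup] at hft
  -- Monotonicity excludes the wrong infinity at each end, and the intermediate value theorem gives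
  -- surjectivity.
  have hmono : ∀ f : ℝ → ℝ, Continuous f → StrictMono f → Tendsto f atBot (atBot ⊔ atTop) →
      Tendsto f atTop (atBot ⊔ atTop) → Function.Surjective f := by
    intro f hfc hm hb ht
    refine hfc.surjective ?_ ?_
    · refine tendsto_atTop.2 fun M => ?_
      have : {x : ℝ | x < f 0} ∪ {x | M ≤ x} ∈ (atBot ⊔ atTop : Filter ℝ) :=
        union_mem_sup (Iio_mem_atBot _) (Ici_mem_atTop M)
      filter_upwards [ht this, Ici_mem_atTop 0] with s hs hs0
      rcases hs with hs | hs
      · exact absurd (hm.monotone hs0) (not_le.2 hs)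
      · exact hs
    · refine tendsto_atBot.2 fun M => ?_
      have : {x : ℝ | x ≤ M} ∪ {x | f 0 < x} ∈ (atBot ⊔ atTop : Filter ℝ) :=
        union_mem_sup (Iic_mem_atBot M) (Ioi_mem_atTop _)
      filter_upwards [hb this, Iic_mem_atBot 0] with s hs hs0
      rcases hs with hs | hs
      · exact hs
      · exact absurd (hm.monotone hs0) (not_le.2 hs)
  have hsurj : Function.Surjective f := by
    rcases hfc.strictMono_of_inj hfi with hm | hm
    · exact hmono f hfc hm hft.1 hft.2
    · have h1 := hmono (f ∘ Neg.neg) (hfc.comp continuous_neg)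
        (fun a b hab => hm (neg_lt_neg hab))
        (hft.2.comp tendsto_neg_atBot_atTop) (hft.1.comp tendsto_neg_atTop_atBot)
      exact Function.Surjective.of_comp h1
  rw [← hfe, hsurj.range_comp]

/-! ### The chain through the tiles of a path tiling. -/

namespace PathTiling

variable (X : PathTiling)

/-- The vertices of the chain that runs through the tiles along their decorations: it enters the
tile `k` at vertex `2 * k`, and passes the junction of its decoration at vertex `2 * k + 1`. -/
def vertex (m : ℤ) : Plane :=
  if m % 2 = 0 then X.tile (m / 2) (conn (X.entry (m / 2))) else X.tile (m / 2) junction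

theorem tile_lineMap (k : ℤ) (p q : Plane) (s : ℝ) :
    X.tile k (AffineMap.lineMap p q s) = AffineMap.lineMap (X.tile k p) (X.tile k q) s := by
  obtain ⟨f, hf⟩ := exists_affineIsometry (X.tile k)
  rw [← hf, ← hf, ← hf]
  exact AffineMap.apply_lineMap f.toAffineEquiv.toAffineMap p q s

theorem polyline_entry (k : ℤ) {f : ℝ} (h0 : 0 ≤ f) (h1 : f ≤ 1) :
    polyline X.vertex (2 * k + f) =
      X.tile k (AffineMap.lineMap (conn (X.entry k)) junction f) := by
  rw [polyline_eq X.vertex (2 * k) (by push_cast; linarith) (by push_cast; linarith),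
    tile_lineMap]
  have e1 : X.vertex (2 * k) = X.tile k (conn (X.entry k)) := by
    rw [vertex, if_pos (by omega), show 2 * k / 2 = k by omega]
  have e2 : X.vertex (2 * k + 1) = X.tile k junction := by
    rw [vertex, if_neg (by omega), show (2 * k + 1) / 2 = k by omega]
  rw [e1, e2]
  congr 1
  push_cast
  ring

theorem polyline_exit (k : ℤ) {f : ℝ} (h0 : 0 ≤ f) (h1 : f ≤ 1) :
    polyline X.vertex (2 * k + 1 + f) =
      X.tile k (AffineMap.lineMap junction (conn (X.exit k)) f) := by
  rw [polyline_eq X.vertex (2 * k + 1) (by push_cast; linarith) (by push_cast; linarith),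
    tile_lineMap, X.exit_eq_entry]
  have e1 : X.vertex (2 * k + 1 + 1) = X.tile (k + 1) (conn (X.entry (k + 1))) := by
    rw [vertex, if_pos (by omega), show (2 * k + 1 + 1) / 2 = k + 1 by omega]
  have e2 : X.vertex (2 * k + 1) = X.tile k junction := by
    rw [vertex, if_neg (by omega), show (2 * k + 1) / 2 = k by omega]
  rw [e1, e2]
  congr 1
  push_cast
  ring

theorem lineMap_junction_mem_arm (x : Fin 3) {f : ℝ} (h0 : 0 ≤ f) (h1 : f ≤ 1) :
    AffineMap.lineMap junction (conn x) f ∈ arm x := by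
  rw [arm, segment_eq_image_lineMap]
  exact ⟨f, ⟨h0, h1⟩, rfl⟩

theorem lineMap_conn_mem_arm (x : Fin 3) {f : ℝ} (h0 : 0 ≤ f) (h1 : f ≤ 1) :
    AffineMap.lineMap (conn x) junction f ∈ arm x := by
  rw [arm, segment_symm, segment_eq_image_lineMap]
  exact ⟨f, ⟨h0, h1⟩, rfl⟩

theorem lineMap_injective {p q : Plane} (h : p ≠ q) {s t : ℝ}
    (hst : (AffineMap.lineMap p q s : Plane) = AffineMap.lineMap p q t) : s = t :=
  AffineMap.lineMap_injective ℝ h hst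

/-- Every time belongs to the passage through one of the two arms of one tile. -/
theorem exists_time (s : ℝ) : ∃ (k : ℤ) (f : ℝ), 0 ≤ f ∧ f < 1 ∧
    (s = 2 * k + f ∨ s = 2 * k + 1 + f) := by
  rcases Int.even_or_odd' ⌊s⌋ with ⟨k, hk | hk⟩
  · refine ⟨k, Int.fract s, Int.fract_nonneg s, Int.fract_lt_one s, Or.inl ?_⟩
    have := Int.floor_add_fract s
    rw [hk] at this
    push_cast at this
    exact this.symm
  · refine ⟨k, Int.fract s, Int.fract_nonneg s, Int.fract_lt_one s, Or.inr ?_⟩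
    have := Int.floor_add_fract s
    rw [hk] at this
    push_cast at this
    exact this.symm

/-- The position at time `s`, in the coordinates of the tile. -/
theorem exists_position (s : ℝ) : ∃ (k : ℤ) (p : Plane), polyline X.vertex s = X.tile k p ∧
    p ∈ decoration ∧ p ≠ conn (X.exit k) ∧ ∃ f : ℝ, 0 ≤ f ∧ f < 1 ∧
    ((s = 2 * k + f ∧ p = AffineMap.lineMap (conn (X.entry k)) junction f ∧
        p ∈ arm (X.entry k) ∧ p ≠ junction) ∨
      (s = 2 * k + 1 + f ∧ p = AffineMap.lineMap junction (conn (X.exit k)) f ∧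
        p ∈ arm (X.exit k))) := by
  obtain ⟨k, f, h0, h1, rfl | rfl⟩ := exists_time s
  · have hm := lineMap_conn_mem_arm (X.entry k) h0 h1.le
    refine ⟨k, _, X.polyline_entry k h0 h1.le, arm_subset_decoration _ hm, fun h => ?_, f, h0, h1,
      Or.inl ⟨rfl, rfl, hm, fun h => ?_⟩⟩
    · rw [h] at hm
      exact X.entry_ne_exit k (eq_of_conn_mem_arm hm).symm
    · have := lineMap_injective (conn_ne_junction (X.entry k)) (s := f) (t := 1) (by simpa using h)
      linarith
  · have hm := lineMap_junction_mem_arm (X.exit k) h0 h1.le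
    refine ⟨k, _, X.polyline_exit k h0 h1.le, arm_subset_decoration _ hm, fun h => ?_, f, h0, h1,
      Or.inr ⟨rfl, rfl, hm⟩⟩
    have := lineMap_injective (conn_ne_junction (X.exit k)).symm (s := f) (t := 1)
      (by simpa using h)
    linarith

/-- A point common to two tiles is the exit of the earlier one, and `exists_position` assigns that
point to the later tile. Within a tile, the two arms share only the junction, which is assigned to
the exit arm. -/
theorem polyline_injective : Function.Injective (polyline X.vertex) := by
  intro s t hst
  obtain ⟨k, p, hp, hpd, hpe, f, hf0, hf1, hf⟩ := X.exists_position s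
  obtain ⟨l, q, hq, hqd, hqe, g, hg0, hg1, hg⟩ := X.exists_position t
  rw [hp, hq] at hst
  have hkl : k = l := by
    by_contra hne
    rcases X.eq_exit_of_mem_decoration hne (mem_image_of_mem _ hpd)
      (hst ▸ mem_image_of_mem _ hqd) with ⟨-, h⟩ | ⟨-, h⟩
    · exact hpe ((X.tile k).injective h)
    · rw [hst] at h
      exact hqe ((X.tile l).injective h)
  subst hkl
  have hpq : p = q := (X.tile k).injective hst
  subst hpq
  rcases hf with ⟨rfl, hf, hfa, hfj⟩ | ⟨rfl, hf, hfa⟩ <;>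
    rcases hg with ⟨rfl, hg, hga, hgj⟩ | ⟨rfl, hg, hga⟩
  · rw [lineMap_injective (conn_ne_junction _) (hf.symm.trans hg)]
  · exact absurd (eq_junction_of_mem_arm (X.entry_ne_exit k) hfa hga) hfj
  · exact absurd (eq_junction_of_mem_arm (X.entry_ne_exit k) hga hfa) hgj
  · rw [lineMap_injective (conn_ne_junction _).symm (hf.symm.trans hg)]

theorem arms_subset_range (k : ℤ) {p : Plane} (hp : p ∈ arm (X.entry k) ∨ p ∈ arm (X.exit k)) :
    X.tile k p ∈ range (polyline X.vertex) := by
  rcases hp with hp | hp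
  · rw [arm, segment_symm, segment_eq_image_lineMap] at hp
    obtain ⟨f, ⟨h0, h1⟩, rfl⟩ := hp
    exact ⟨_, X.polyline_entry k h0 h1⟩
  · rw [arm, segment_eq_image_lineMap] at hp
    obtain ⟨f, ⟨h0, h1⟩, rfl⟩ := hp
    exact ⟨_, X.polyline_exit k h0 h1⟩

theorem image_decoration_subset (k : ℤ) : X.tile k '' decoration ⊆ gridSquare (X.cell k) := by
  rw [← X.image_tile]
  exact image_mono decoration_subset_squareTile

theorem tendsto_polyline : Tendsto (polyline X.vertex) (cocompact ℝ) (cocompact Plane) := by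
  rw [hasBasis_cocompact.tendsto_right_iff]
  intro K hK
  obtain ⟨R, hR⟩ := hK.isBounded.subset_closedBall 0
  obtain ⟨a, ha⟩ := (X.finite_meeting 0 R).bddBelow
  obtain ⟨b, hb⟩ := (X.finite_meeting 0 R).bddAbove
  filter_upwards [(isCompact_Icc (a := (2 * a : ℝ)) (b := 2 * b + 2)).compl_mem_cocompact]
    with s hs hsK
  obtain ⟨k, p, hp, hpd, -, f, hf0, hf1, hf⟩ := X.exists_position s
  have hk : k ∈ {k | (gridSquare (X.cell k) ∩ Metric.closedBall 0 R).Nonempty} :=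
    ⟨_, X.image_decoration_subset k (mem_image_of_mem _ hpd), hp ▸ hR hsK⟩
  have h1 : (a : ℝ) ≤ k := by exact_mod_cast ha hk
  have h2 : (k : ℝ) ≤ b := by exact_mod_cast hb hk
  refine hs ⟨?_, ?_⟩ <;> rcases hf with ⟨rfl, -⟩ | ⟨rfl, -⟩ <;> linarith

theorem isUnlimitedSelfAvoiding : IsUnlimitedSelfAvoiding (polyline X.vertex) :=
  ⟨continuous_polyline _, X.polyline_injective, X.tendsto_polyline⟩

theorem range_subset_decorationUnion : range (polyline X.vertex) ⊆ decorationUnion X.tiles := by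
  rw [decorationUnion_eq]
  rintro _ ⟨s, rfl⟩
  obtain ⟨k, p, hp, hpd, -⟩ := X.exists_position s
  rw [hp]
  exact mem_iUnion.2 ⟨k, mem_image_of_mem _ hpd⟩

theorem isPlaneFilling : IsPlaneFilling (range (polyline X.vertex)) := by
  -- Any bound above the diagonal `3√2` of a cell works, as each cell contains a junction of the
  -- chain.
  refine ⟨6, fun p => ?_⟩
  obtain ⟨k, hk⟩ := X.exists_mem_gridSquare p
  refine ⟨_, X.arms_subset_range k (Or.inl (junction_mem_arm _)), ?_⟩
  have hj := X.image_decoration_subset k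
    (mem_image_of_mem _ (arm_subset_decoration 0 (junction_mem_arm 0)))
  obtain ⟨h1, h2, h3, h4⟩ := hk
  obtain ⟨k1, k2, k3, k4⟩ := hj
  rw [EuclideanSpace.dist_eq, Fin.sum_univ_two, Real.sqrt_le_left (by norm_num)]
  simp only [Real.dist_eq, sq_abs]
  nlinarith

theorem isHilbertChain (h : IsInfiniteHilbertOrder X.cell) : IsHilbertChain X.tiles X.vertex := by
  refine ⟨X.cell, X.tile, fun k => 2 * k, h, X.tile_injective, rfl, X.image_tile,
    fun a b hab => by dsimp only; omega, fun k => ?_⟩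
  rintro _ ⟨s, ⟨h1, h2⟩, rfl⟩
  push_cast at h1 h2
  rcases le_total s (2 * k + 1) with h3 | h3
  · rw [show s = 2 * k + (s - 2 * k) by ring, X.polyline_entry k (by linarith) (by linarith)]
    exact mem_image_of_mem _ (arm_subset_decoration _
      (lineMap_conn_mem_arm _ (by linarith) (by linarith)))
  · rw [show s = 2 * k + 1 + (s - (2 * k + 1)) by ring,
      X.polyline_exit k (by linarith) (by linarith)]
    exact mem_image_of_mem _ (arm_subset_decoration _
      (lineMap_junction_mem_arm _ (by linarith) (by linarith)))

/-! ### Dead ends and uniqueness of the curve. -/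

theorem isCompact_arm (x : Fin 3) : IsCompact (arm x) := by
  rw [arm, segment_eq_image_lineMap]
  exact isCompact_Icc.image AffineMap.lineMap_continuous

/-- The part of the decoration of the tile `l` that does not belong to the dead end of the
tile `k`. -/
def rest (k l : ℤ) : Set Plane :=
  if l = k then X.tile k '' (arm (X.entry k) ∪ arm (X.exit k)) else X.tile l '' decoration

/-- A locally finite union of compact sets. Closedness is needed to split the image of a connected
set between a dead end and the rest. -/
theorem isClosed_iUnion_rest (k : ℤ) : IsClosed (⋃ l, X.rest k l) := by
  have hdec : IsCompact decoration := by
    have : decoration = ⋃ x, arm x := by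
      ext p
      rw [mem_decoration_iff_arm, mem_iUnion]
    rw [this]
    exact isCompact_iUnion isCompact_arm
  refine (X.locallyFinite_gridSquare.subset fun l => ?_).isClosed_iUnion fun l => ?_
  · unfold rest
    split_ifs with h
    · subst h
      refine (image_mono ?_).trans (X.image_decoration_subset l)
      exact union_subset (arm_subset_decoration _) (arm_subset_decoration _)
    · exact X.image_decoration_subset l
  · unfold rest
    split_ifs with h
    · exact (((isCompact_arm _).union (isCompact_arm _)).image (X.tile k).continuous).isClosed
    · exact (hdec.image (X.tile l).continuous).isClosed

theorem decorationUnion_subset (k : ℤ) :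
    decorationUnion X.tiles ⊆ X.tile k '' arm (X.dead k) ∪ ⋃ l, X.rest k l := by
  rw [decorationUnion_eq]
  intro p hp
  obtain ⟨l, q, hq, rfl⟩ := mem_iUnion.1 hp
  rcases eq_or_ne l k with rfl | h
  · obtain ⟨x, hx⟩ := mem_decoration_iff_arm.1 hq
    have hr : X.rest l l = X.tile l '' (arm (X.entry l) ∪ arm (X.exit l)) := if_pos rfl
    rcases eq_of_ne_of_ne (x := x) (X.entry_ne_exit l) (X.entry_ne_dead l) (X.exit_ne_dead l) with
      rfl | rfl | rfl
    · exact Or.inr (mem_iUnion.2 ⟨l, hr ▸ mem_image_of_mem _ (Or.inl hx)⟩)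
    · exact Or.inr (mem_iUnion.2 ⟨l, hr ▸ mem_image_of_mem _ (Or.inr hx)⟩)
    · exact Or.inl (mem_image_of_mem _ hx)
  · have hr : X.rest k l = X.tile l '' decoration := if_neg h
    exact Or.inr (mem_iUnion.2 ⟨l, hr ▸ mem_image_of_mem _ hq⟩)

/-- A dead end is attached to the rest of the decorations only at the junction. -/
theorem dead_inter_rest (k : ℤ) {p : Plane} (hp : p ∈ arm (X.dead k))
    (hr : X.tile k p ∈ ⋃ l, X.rest k l) : p = junction := by
  obtain ⟨l, hl⟩ := mem_iUnion.1 hr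
  unfold rest at hl
  split_ifs at hl with h
  · obtain ⟨q, hq, hqp⟩ := hl
    obtain rfl := (X.tile k).injective hqp
    rcases hq with hq | hq
    · exact eq_junction_of_mem_arm (X.entry_ne_dead k) hq hp
    · exact eq_junction_of_mem_arm (X.exit_ne_dead k) hq hp
  · rcases X.eq_entry_or_exit (Ne.symm h) hl (arm_subset_decoration _ hp) with rfl | rfl
    · exact absurd (eq_of_conn_mem_arm hp) (X.entry_ne_dead k)
    · exact absurd (eq_of_conn_mem_arm hp) (X.exit_ne_dead k)

/-- An unlimited self-avoiding curve in the decorations does not enter a dead end. -/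
theorem eq_junction_of_mem_dead {γ : ℝ → Plane} (hγ : IsUnlimitedSelfAvoiding γ)
    (hU : range γ ⊆ decorationUnion X.tiles) {k : ℤ} {s : ℝ} {p : Plane}
    (hs : γ s = X.tile k p) (hp : p ∈ arm (X.dead k)) : p = junction := by
  by_contra hne
  obtain ⟨hγ1, hγ2, hγ3⟩ := hγ
  have hcpt : IsCompact (X.tile k '' arm (X.dead k)) :=
    (isCompact_arm _).image (X.tile k).continuous
  -- on a half-line without the junction, the curve stays in the dead end
  have hstay : ∀ I : Set ℝ, IsPreconnected I → s ∈ I → (∀ t ∈ I, γ t ≠ X.tile k junction) →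
      ∀ t ∈ I, γ t ∈ X.tile k '' arm (X.dead k) := by
    intro I hI hsI hJ t ht
    by_contra hout
    have hpre := hI.image γ hγ1.continuousOn
    have hcover : γ '' I ⊆ X.tile k '' arm (X.dead k) ∪ ⋃ l, X.rest k l :=
      (image_subset_range γ I).trans (hU.trans (X.decorationUnion_subset k))
    obtain ⟨_, ⟨r, hr, rfl⟩, ⟨q, hq, hqr⟩, hrest⟩ := isPreconnected_closed_iff.1 hpre _ _
      hcpt.isClosed (X.isClosed_iUnion_rest k) hcover
      ⟨γ s, mem_image_of_mem γ hsI, hs ▸ mem_image_of_mem _ hp⟩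
      ⟨γ t, mem_image_of_mem γ ht, (hcover (mem_image_of_mem γ ht)).resolve_left hout⟩
    rw [← hqr] at hrest
    apply hJ r hr
    rw [← hqr, X.dead_inter_rest k hq hrest]
  have hleave : ∀ᶠ t in cocompact ℝ, γ t ∉ X.tile k '' arm (X.dead k) :=
    hγ3 hcpt.compl_mem_cocompact
  -- By injectivity the junction is visited at most once, and not at time `s`; so the past or the
  -- future of `s` is free of it and stays in the compact dead end, contradicting unlimitedness.
  by_cases h : ∃ t, s ≤ t ∧ γ t = X.tile k junction
  · obtain ⟨t, hst, ht⟩ := h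
    have hIic := hstay (Iic s) isPreconnected_Iic self_mem_Iic fun r hr hrJ => by
      have hrt : r = t := hγ2 (hrJ.trans ht.symm)
      have hrs : s = r := le_antisymm (hrt ▸ hst) hr
      rw [← hrs, hs] at hrJ
      exact hne ((X.tile k).injective hrJ)
    obtain ⟨t, ht1, ht2⟩ := ((hleave.filter_mono atBot_le_cocompact).and (Iic_mem_atBot s)).exists
    exact ht1 (hIic t ht2)
  · push Not at h
    have hIci := hstay (Ici s) isPreconnected_Ici self_mem_Ici fun r hr => h r hr
    obtain ⟨t, ht1, ht2⟩ := ((hleave.filter_mono atTop_le_cocompact).and (Ici_mem_atTop s)).exists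
    exact ht1 (hIci t ht2)

theorem range_eq_of_subset {γ : ℝ → Plane} (hγ : IsUnlimitedSelfAvoiding γ)
    (hU : range γ ⊆ decorationUnion X.tiles) : range γ = range (polyline X.vertex) := by
  refine range_eq_of_range_subset hγ X.isUnlimitedSelfAvoiding ?_
  rintro _ ⟨s, rfl⟩
  have h := hU (mem_range_self s)
  rw [decorationUnion_eq] at h
  obtain ⟨k, p, hp, hps⟩ := mem_iUnion.1 h
  rw [← hps]
  obtain ⟨x, hx⟩ := mem_decoration_iff_arm.1 hp
  rcases eq_of_ne_of_ne (x := x) (X.entry_ne_exit k) (X.entry_ne_dead k) (X.exit_ne_dead k) with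
    rfl | rfl | rfl
  · exact X.arms_subset_range k (Or.inl hx)
  · exact X.arms_subset_range k (Or.inr hx)
  · rw [X.eq_junction_of_mem_dead hγ hU hps.symm hx]
    exact X.arms_subset_range k (Or.inl (junction_mem_arm _))

end PathTiling

end HilbertTiling

end

theorem mainTheorem6 :
    (∃ 𝒯 : Set HilbertTiling.Placement,
      HilbertTiling.IsTiling 𝒯 ∧
      HilbertTiling.GeneratedByR2 𝒯 ∧
      IsConnected (HilbertTiling.decorationUnion 𝒯) ∧
      ∃ v : ℤ → HilbertTiling.Plane,
        HilbertTiling.IsHilbertChain 𝒯 v ∧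
        HilbertTiling.IsUnlimitedSelfAvoiding (HilbertTiling.polyline v) ∧
        HilbertTiling.IsPlaneFilling (range (HilbertTiling.polyline v)) ∧
        range (HilbertTiling.polyline v) ⊆ HilbertTiling.decorationUnion 𝒯 ∧
        ∀ γ : ℝ → HilbertTiling.Plane, HilbertTiling.IsUnlimitedSelfAvoiding γ →
          range γ ⊆ HilbertTiling.decorationUnion 𝒯 →
          range γ = range (HilbertTiling.polyline v)) ∧
    ∀ 𝒯 : Set HilbertTiling.Placement,
      HilbertTiling.IsTiling 𝒯 → HilbertTiling.GeneratedByR2 𝒯 →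
        HilbertTiling.IsNonperiodic 𝒯 := by
  obtain ⟨X, hX⟩ := HilbertTiling.exists_pathTiling HilbertTiling.order
    HilbertTiling.order_bijective HilbertTiling.order_step HilbertTiling.order_no_parallel
  have horder : HilbertTiling.IsInfiniteHilbertOrder X.cell := by
    rw [hX]
    exact HilbertTiling.isInfiniteHilbertOrder_order
  exact ⟨⟨X.tiles, X.isTiling, X.generatedByR2, X.isConnected_decorationUnion, X.vertex,
    X.isHilbertChain horder, X.isUnlimitedSelfAvoiding, X.isPlaneFilling,
    X.range_subset_decorationUnion, fun γ hγ hU => X.range_eq_of_subset hγ hU⟩,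
    fun _ ht hr => HilbertTiling.isNonperiodic_of_generatedByR2 ht hr⟩
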